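/- Let $\mathbb K=\mathbb R$ or $\mathbb C$, and let $\mathfrak g$ be a finite-dimensional Lie algebra over $\mathbb K$ with an involutive automorphism $\sigma$; let $\mathfrak g=\mathfrak k\oplus\mathfrak p$ be the decomposition into the $(+1)$- and $(-1)$-eigenspaces of $\sigma$, and put $\delta(k)=\frac12\mathrm{tr}_{\mathfrak p}(\mathrm{ad}\,k)$ for $k\in\mathfrak k$. **Configuration spaces and propagators.** For $n\ge 0$ let $C_{n,2}^+$ be the space of configurations $(z_1,\dots,z_n,x_1,x_2)$ of distinct points $z_i$ in the open upper half-plane and real points $x_1<x_2$, modulo the group $\mathbb R^+\ltimes\mathbb R$ of maps $w\mapsto aw+b$, and let $\mathcal C_{n,2}^+$ be its compactification to a manifold with corners, of dimension $2n$. It is oriented as the quotient of the space of configurations, with orientation $d\mathrm{Re}\,z_1\wedge d\mathrm{Im}\,z_1\wedge\cdots\wedge d\mathrm{Im}\,z_n\wedge dx_1\wedge dx_2$, by $\mathbb R^+\ltimes\mathbb R$, oriented by (dilation, translation): a frame of the quotient is positive if, followed by the generators of dilations and of translations, it is positive upstairs. For a point $w$ of the configuration write $q=\sqrt{w-x_2}$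 for the root in the closed first quadrant, and for signs $\varepsilon_1,\varepsilon_2$ let $$\eta=\frac{\arg q}{2\pi},\qquad \omega^{\varepsilon_1,\varepsilon_2}=\frac1{2\pi}\left[d\arg(q_1-q_2)-\varepsilon_2\,d\arg(\overline q_1-q_2)-\varepsilon_1\,d\arg(\overline q_1+q_2)+\varepsilon_1\varepsilon_2\,d\arg(q_1+q_2)\right],$$ the second form being attached to an edge from $w_1$ to $w_2$. Integrals of top-degree forms over $\mathcal C_{n,2}^+$ are computed on the interior $C_{n,2}^+$. **The operator $\mathbb A$.** Regard elements of $\mathfrak g$ as linear functions on $X=\mathfrak g^*$, choose a basis $(x_i)$ of $\mathfrak g$ consisting of a basis of $\mathfrak k$ and a basis of $\mathfrak p$, and give $i$ the colour $c(i)=(+,+)$ if $x_i\in\mathfrak p$ and $c(i)=(+,-)$ if $x_i\in\mathfrak k$. Let $\pi=\frac12\sum_{i,j}[x_i,x_j]\,\partial_i\wedge\partial_j$ be the linear Poisson bivector. An admissible graph of type $(n,2)$ is an oriented graph on the vertices $z_1,\dots,z_n,x_1,x_2$, possibly with multiple edges and with simple short loops at the $z_i$. To an edge $e=(v,w)$,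 $v\ne w$, attach $\omega_e=\sum_i\omega^{c(i)}(v,w)\otimes\iota_{dx_i}^{(v)}\partial_{x_i}^{(w)}$, and to a short loop at $v$ attach $\omega_e=\sum_i\varepsilon_i\,d\eta(v)\otimes\iota_{dx_i}^{(v)}\partial_{x_i}^{(v)}$ with $\varepsilon_i=+1$ for $x_i\in\mathfrak p$ and $\varepsilon_i=-1$ for $x_i\in\mathfrak k$; here $\iota_{dx_i}$ is left contraction of polyvector fields, and $\iota_{dx_i}^{(v)}$, $\partial_{x_i}^{(w)}$ act on the copies of polynomial polyvector fields on $X$ attached to $v$, $w$. Define $\mathbb A=\sum_{n\ge0}\mathbb A_n$ on $\mathrm S(\mathfrak g)$ by $$\mathbb A_n(f)=\frac1{n!}\sum_\Gamma\frac{1}{\Gamma!}\;\mu\left(\int_{\mathcal C_{n,2}^+}\prod_{e}\omega_e\,(\pi\otimes\cdots\otimes\pi\otimes f\otimes1)\right),$$ where $\Gamma$ runs over the admissible graphs of type $(n,2)$ with $2n$ edges, $\Gamma!$ is the product of the factorials of the multiplicities of the multiple edges, $\mu$ is multiplication followed by projection onto functions, products of superpropagators are taken with the Koszul sign rule ($\iota_{dx_i}^{(v)}\partial_{x_i}^{(w)}$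 has degree $-1$), and the integrals are normalized by dividing by the orientation sign $\int_{\mathcal C_{0,2}^+}1$ of the point $\mathcal C_{0,2}^+$, so that $\mathbb A_0=\mathrm{id}$. (Thus $f\star_L1=\mathbb A(f)|_{\mathfrak k^\perp}$ is the left action of biquantization for $U_1=X$, $U_2=\mathfrak k^\perp$, at $\hbar=1$.) **Lemma.** The integral $\int_{\mathcal C_{1,2}^+}d\eta\wedge\omega^{+,-}$, with $\eta$ evaluated at $z_1$ and $\omega^{+,-}$ attached to the edge from $z_1$ to $x_1$, converges absolutely and $$\int_{\mathcal C_{1,2}^+}d\eta\wedge\omega^{+,-}=\frac14 .$$ Moreover, for every $k\in\mathfrak k$, $$\mathbb A_1(k)=\left(\int_{\mathcal C_{1,2}^+}d\eta\wedge\omega^{+,-}\right)\left(\mathrm{tr}_{\mathfrak p}(\mathrm{ad}\,k)-\mathrm{tr}_{\mathfrak k}(\mathrm{ad}\,k)\right),\qquad \mathbb A_n(k)=0\ \ (n\ge2),$$ and therefore $$\mathbb A(k)=k+\delta(k)-\tfrac14\,\mathrm{tr}_{\mathfrak g}(\mathrm{ad}\,k).$$ -/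

import Mathlib

open scoped TensorProduct

noncomputable section

namespace Biquantization

/-! ### Configurations of `n` points in the upper half-plane and two ordered points on the line

The configuration space `C_{n,2}^+` is the quotient of `Conf n` by the group `ℝ⁺ ⋉ ℝ` of real
dilations and translations `w ↦ a w + b`. The second real point `x₂` is the marked point (the common
origin of the two branes); after `w ↦ √(w - x₂)` the upper half-plane becomes the first quadrant,
the real points to the left of `x₂` go to the positive imaginary axis and `x₂` goes to `0`. -/

/-- Coordinates `(z₁, …, z_n; x₁, x₂)`. -/
abbrev ConfCoord (n : ℕ) : Type := (Fin n → ℂ) × (Fin 2 → ℝ)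

/-- Distinct points `z_i` of the open upper half-plane and real points `x₁ < x₂`. -/
def Conf (n : ℕ) : Set (ConfCoord n) :=
  {p | (∀ i, 0 < (p.1 i).im) ∧ Function.Injective p.1 ∧ p.2 0 < p.2 1}

/-- The action of `w ↦ a w + b` on configurations. -/
def affineAct {n : ℕ} (a b : ℝ) (p : ConfCoord n) : ConfCoord n :=
  (fun i => (a : ℂ) * p.1 i + (b : ℂ), fun j => a * p.2 j + b)

/-- The gauge slice `x₁ = -1`, `x₂ = 0`. -/
def slice {n : ℕ} (z : Fin n → ℂ) : ConfCoord n := (z, ![-1, 0])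

/-- The part of the slice that consists of configurations. -/
def sliceDomain (n : ℕ) : Set (Fin n → ℂ) := {z | slice z ∈ Conf n}

/-- Every orbit of `ℝ⁺ ⋉ ℝ` in `Conf n` meets the slice exactly once, with trivial stabilizer, so the
slice is a global chart of the quotient `C_{n,2}^+`. -/
theorem exists_unique_slice {n : ℕ} (p : ConfCoord n) (hp : p ∈ Conf n) :
    ∃! g : ℝ × ℝ, 0 < g.1 ∧ ∃ z ∈ sliceDomain n, affineAct g.1 g.2 p = slice z := by
  obtain ⟨h1, h2, h3⟩ := hp
  have hd : 0 < p.2 1 - p.2 0 := sub_pos.mpr h3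
  have hd' : p.2 1 - p.2 0 ≠ 0 := hd.ne'
  have ha : 0 < (p.2 1 - p.2 0)⁻¹ := inv_pos.mpr hd
  refine ⟨((p.2 1 - p.2 0)⁻¹, -((p.2 1 - p.2 0)⁻¹ * p.2 1)), ⟨ha, ?_⟩, ?_⟩
  · refine ⟨_, ?_, Prod.ext rfl ?_⟩
    · refine ⟨fun i => ?_, fun i j hij => h2 ?_, by simp [slice]⟩
      · have := mul_pos ha (h1 i)
        simp only [slice, Complex.add_im,
          Complex.im_ofReal_mul, Complex.ofReal_im, add_zero]
        exact this
      · have hc : (((p.2 1 - p.2 0)⁻¹ : ℝ) : ℂ) ≠ 0 := by exact_mod_cast ha.ne'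
        exact mul_left_cancel₀ hc (add_right_cancel hij)
    · funext j
      fin_cases j
      · simp only [affineAct, slice, Fin.zero_eta, Matrix.cons_val_zero]
        field_simp
        ring
      · simp [affineAct, slice]
  · rintro ⟨a, b⟩ ⟨-, z, -, hz⟩
    have e0 : a * p.2 0 + b = -1 := by
      simpa [affineAct, slice] using congrFun (congrArg Prod.snd hz) 0
    have e1 : a * p.2 1 + b = 0 := by
      simpa [affineAct, slice] using congrFun (congrArg Prod.snd hz) 1
    have ea : a = (p.2 1 - p.2 0)⁻¹ := by
      apply eq_inv_of_mul_eq_one_left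
      linarith
    exact Prod.ext ea (by simp only; rw [← ea]; linarith)

/-! ### Integration over `C_{n,2}^+` -/

/-- Differential 1-forms (in the coordinates of the configuration space). -/
abbrev OneForm (n : ℕ) : Type := ConfCoord n → (ConfCoord n →L[ℝ] ℝ)

/-- The standard frame `∂/∂Re z₁, ∂/∂Im z₁, …, ∂/∂Re z_n, ∂/∂Im z_n` of the slice. -/
def frame (n : ℕ) (l : Fin (n * 2)) : ConfCoord n :=
  (Pi.single (finProdFinEquiv.symm l).1
    (if (finProdFinEquiv.symm l).2 = 0 then 1 else Complex.I), 0)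

/-- The orientation of the slice induced from the quotient. The manifold `Conf n` is oriented by
`dRe z₁ ∧ dIm z₁ ∧ ⋯ ∧ dx₁ ∧ dx₂` and the group `ℝ⁺ ⋉ ℝ` by (dilation, translation); a frame
of the quotient is positive if followed by the generators of dilations and of translations it is
positive in `Conf n`. On the slice these generators have `(x₁, x₂)`-components `(-1, 0)` and
`(1, 1)`, the columns of the matrix below. -/
def orientationSign : ℝ := (!![-1, 1; 0, 1] : Matrix (Fin 2) (Fin 2) ℝ).det

/-- The coefficient of `α₁ ∧ ⋯ ∧ α_{2n}` on the slice: its value on the standard frame. -/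
def density {n : ℕ} (α : Fin (n * 2) → OneForm n) (z : Fin n → ℂ) : ℝ :=
  (Matrix.of fun j l => α j (slice z) (frame n l)).det

/-- Absolute convergence of `∫ α₁ ∧ ⋯ ∧ α_{2n}` over the configuration space. -/
def ConfIntegrable {n : ℕ} (α : Fin (n * 2) → OneForm n) : Prop :=
  MeasureTheory.IntegrableOn (density α) (sliceDomain n)

/-- `∫ α₁ ∧ ⋯ ∧ α_{2n}` over the oriented configuration space. The compactification adds only a
boundary, which does not change the integral of a top degree form. -/
def confIntegral {n : ℕ} (α : Fin (n * 2) → OneForm n) : ℝ :=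
  orientationSign * ∫ z in sliceDomain n, density α z

/-! ### The propagators -/

/-- Vertices: `Sum.inl i` is the point `z_i`, `Sum.inr j` is the real point `x_j`. -/
abbrev Vert (n : ℕ) : Type := Fin n ⊕ Fin 2

/-- The position of a vertex. -/
def pos {n : ℕ} (v : Vert n) (p : ConfCoord n) : ℂ := Sum.elim p.1 (fun j => (p.2 j : ℂ)) v

/-- The position of a vertex in the closed first quadrant, `√(w - x₂)`. -/
def qpos {n : ℕ} (v : Vert n) (p : ConfCoord n) : ℂ :=
  (pos v p - (p.2 1 : ℂ)) ^ (1 / 2 : ℂ)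

/-- The closed 1-form `d arg h = Im (dh / h)`. -/
def dArg {n : ℕ} (h : ConfCoord n → ℂ) : OneForm n := fun p =>
  Complex.imCLM.comp ((h p)⁻¹ • fderiv ℝ h p)

/-- The four-coloured propagators `ω^{ε₁,ε₂}` for an edge from `v` to `w`. With `q₁`, `q₂` the
positions in the quadrant, `2π ω^{ε₁,ε₂}` is
`d arg (q₁ - q₂) - ε₂ d arg (q̄₁ - q₂) - ε₁ d arg (q̄₁ + q₂) + ε₁ ε₂ d arg (q₁ + q₂)`. -/
def omega {n : ℕ} (ε₁ ε₂ : ℤˣ) (v w : Vert n) : OneForm n := fun p =>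
  (2 * Real.pi)⁻¹ •
    (dArg (fun p => qpos v p - qpos w p) p
      - ((ε₂ : ℤ) : ℝ) • dArg (fun p => (starRingEnd ℂ) (qpos v p) - qpos w p) p
      - ((ε₁ : ℤ) : ℝ) • dArg (fun p => (starRingEnd ℂ) (qpos v p) + qpos w p) p
      + (((ε₁ * ε₂ : ℤˣ) : ℤ) : ℝ) • dArg (fun p => qpos v p + qpos w p) p)

/-- The normalized angle function `η = arg (q) / 2π` of a point `q` of the first quadrant. -/
def eta {n : ℕ} (v : Vert n) (p : ConfCoord n) : ℝ := Complex.arg (qpos v p) / (2 * Real.pi)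

/-- The exact 1-form `dη`. -/
def dEta {n : ℕ} (v : Vert n) : OneForm n := fun p => fderiv ℝ (eta v) p

/-- The integrand `dη ∧ ω^{+,-}` on `C_{1,2}^+`: a short loop at `z₁` and an edge from `z₁` to the
unmarked real point. -/
def loopForms : Fin (1 * 2) → OneForm 1 :=
  ![dEta (Sum.inl 0), omega 1 (-1) (Sum.inl 0) (Sum.inr 0)]

/-! ### Polyvector fields on `X = 𝔤*` -/

section Algebra

variable (𝕜 : Type*) [RCLike 𝕜]

/-- `T_poly(X)^{⊗ V}`, for `X` with linear coordinates `x_i`, `i ∈ ι`: polynomials in `x_i^{(v)}`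
tensor the exterior algebra on the `∂_i^{(v)}`. -/
abbrev TPoly (V ι : Type*) : Type _ :=
  MvPolynomial (V × ι) 𝕜 ⊗[𝕜] ExteriorAlgebra 𝕜 ((V × ι) → 𝕜)

/-- The operator `ι_{dx_i}^{(v)} ∂_{x_i}^{(w)}` of degree `-1`. -/
def tau {V ι : Type*} (v w : V) (i : ι) : Module.End 𝕜 (TPoly 𝕜 V ι) :=
  TensorProduct.map (MvPolynomial.pderiv (R := 𝕜) (w, i)).toLinearMap
    (CliffordAlgebra.contractLeft (LinearMap.proj (R := 𝕜) (φ := fun _ : V × ι => 𝕜) (v, i)))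

/-- Multiplication `T_poly(X)^{⊗ V} → T_poly(X)`, followed by the projection onto functions. -/
def mulToFunctions (V ι : Type*) : TPoly 𝕜 V ι →ₗ[𝕜] MvPolynomial ι 𝕜 :=
  (TensorProduct.rid 𝕜 (MvPolynomial ι 𝕜)).toLinearMap ∘ₗ
    TensorProduct.map (MvPolynomial.rename (R := 𝕜) (Prod.snd : V × ι → ι)).toLinearMap
      (ExteriorAlgebra.algebraMapInv (R := 𝕜) (M := (V × ι) → 𝕜)).toLinearMap

variable {𝕜} {𝔤 ι₁ ι₂ : Type*} [LieRing 𝔤] [LieAlgebra 𝕜 𝔤] [Fintype ι₁] [Fintype ι₂]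

open Classical in
/-- The linear Poisson bivector `½ ∑ c_{ij}^l x_l ∂_i ∧ ∂_j` of `𝔤*`, in the copy of `T_poly(X)`
at the vertex `v`; the coordinates of `𝔤*` are the elements of the basis `b` of `𝔤`. -/
def poissonAt {V : Type*} (b : Module.Basis (ι₁ ⊕ ι₂) 𝕜 𝔤) (v : V) : TPoly 𝕜 V (ι₁ ⊕ ι₂) :=
  (1 / 2 : 𝕜) • ∑ i, ∑ j,
    (∑ l, MvPolynomial.C (b.repr ⁅b i, b j⁆ l) * MvPolynomial.X (v, l)) ⊗ₜ[𝕜]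
      (ExteriorAlgebra.ι 𝕜 (Pi.single (v, i) (1 : 𝕜)) *
        ExteriorAlgebra.ι 𝕜 (Pi.single (v, j) (1 : 𝕜)))

/-! ### The left action of biquantization for `U₁ = X = 𝔤*`, `U₂ = 𝔨^⊥`

The basis `b` of `𝔤 = 𝔨 ⊕ 𝔭` is adapted: `ι₁` indexes a basis of `𝔨`, `ι₂` a basis of `𝔭`. The
elements of `𝔭` are coordinates on `U₁ ∩ U₂`, of colour `(+,+)`, and the elements of `𝔨` are
coordinates on `U₁ ∩ U₂^⊥`, of colour `(+,-)`. -/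

/-- The colour of a coordinate. -/
def colour : ι₁ ⊕ ι₂ → ℤˣ × ℤˣ := Sum.elim (fun _ => (1, -1)) (fun _ => (1, 1))

/-- The 1-form of an edge of colour `c`: the propagator `ω^{ε₁,ε₂}`, and `ε₁ ε₂ dη` for a short
loop, so that `∑_i edgeForm (colour i) e ⊗ ι_{dx_i} ∂_{x_i}` is the superpropagator, respectively
the superloop propagator `dη ⊗ (div⁺ - div⁻)`. -/
def edgeForm {n : ℕ} (c : ℤˣ × ℤˣ) (e : Vert n × Vert n) : OneForm n :=
  if e.1 = e.2 then (((c.1 * c.2 : ℤˣ) : ℤ) : ℝ) • dEta e.1 else omega c.1 c.2 e.1 e.2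

/-- Admissible graphs of type `(n, 2)` with `2n = dim C_{n,2}^+` edges, listed in some order.
Multiple edges and edges that depart from real vertices are allowed; short loops are allowed at
the vertices of the first type, without multiplicity. -/
def IsAdmissible {n : ℕ} (Γ : Fin (n * 2) → Vert n × Vert n) : Prop :=
  (∀ e j, Γ e ≠ (Sum.inr j, Sum.inr j)) ∧
    ∀ e e', (Γ e).1 = (Γ e).2 → Γ e = Γ e' → e = e'

/-- The sign in `∏ (ω_j ⊗ τ_j) = ± (ω_1 ∧ ⋯ ∧ ω_N) ⊗ (τ_1 ⋯ τ_N)`, the forms `ω_j` and the operators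
`τ_j` being odd. -/
def koszulSign (N : ℕ) : ℝ := (-1) ^ (N * (N - 1) / 2)

/-- The integral weight of a product of edge forms. Signs are taken relative to the graph with no
edges, that is, to the orientation of the point `C_{0,2}^+`, so that this graph acts by the
undeformed multiplication. -/
def weight {n : ℕ} (α : Fin (n * 2) → OneForm n) : ℝ :=
  koszulSign (n * 2) * confIntegral α / confIntegral (n := 0) (fun e => e.elim0)

/-- The integral over `C_{n,2}^+` of the product over the edges of `Γ` of the superpropagators. -/
def graphOperator {n : ℕ} (Γ : Fin (n * 2) → Vert n × Vert n) :
    Module.End 𝕜 (TPoly 𝕜 (Vert n) (ι₁ ⊕ ι₂)) :=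
  ∑ i : Fin (n * 2) → ι₁ ⊕ ι₂,
    ((weight (fun e => edgeForm (colour (i e)) (Γ e)) : ℝ) : 𝕜) •
      (List.ofFn fun e => tau 𝕜 (Γ e).1 (Γ e).2 (i e)).prod

/-- The element `π ⊗ ⋯ ⊗ π ⊗ f ⊗ h` of `T_poly(X)^{⊗ (n + 2)}`. -/
def graphInput (n : ℕ) (b : Module.Basis (ι₁ ⊕ ι₂) 𝕜 𝔤) (f h : MvPolynomial (ι₁ ⊕ ι₂) 𝕜) :
    TPoly 𝕜 (Vert n) (ι₁ ⊕ ι₂) :=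
  (List.ofFn fun i : Fin n => poissonAt b (Sum.inl i : Vert n)).prod *
    ((MvPolynomial.rename (fun i => ((Sum.inr 0 : Vert n), i)) f *
      MvPolynomial.rename (fun i => ((Sum.inr 1 : Vert n), i)) h) ⊗ₜ[𝕜] 1)

open Classical in
/-- The bidifferential operator `(1 / n!) ∑_Γ O_Γ(π | ⋯ | π | f | h)`, with values in functions
on `X` (its restriction to `U₁ ∩ U₂ = 𝔨^⊥` is the `n`-th term of the left action `f ⋆_L h`).
Summing over graphs with ordered edges and dividing by the number `(2n)!` of orders is the same as
summing over graphs and dividing by the factorials of the multiplicities of their multiple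
edges, because superpropagators have total degree `0` and commute. -/
def leftActionTerm (n : ℕ) (b : Module.Basis (ι₁ ⊕ ι₂) 𝕜 𝔤) (f h : MvPolynomial (ι₁ ⊕ ι₂) 𝕜) :
    MvPolynomial (ι₁ ⊕ ι₂) 𝕜 :=
  ((n.factorial : 𝕜)⁻¹ * ((n * 2).factorial : 𝕜)⁻¹) •
    ∑ Γ : Fin (n * 2) → Vert n × Vert n with IsAdmissible Γ,
      mulToFunctions 𝕜 (Vert n) (ι₁ ⊕ ι₂) (graphOperator Γ (graphInput n b f h))

/-- The homogeneous part `𝔸_n` of `𝔸`, acting on `S(𝔤)`: the action on `h = 1`. -/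
def opATerm (b : Module.Basis (ι₁ ⊕ ι₂) 𝕜 𝔤) (n : ℕ) (f : SymmetricAlgebra 𝕜 𝔤) :
    SymmetricAlgebra 𝕜 𝔤 :=
  (SymmetricAlgebra.equivMvPolynomial b).symm
    (leftActionTerm n b (SymmetricAlgebra.equivMvPolynomial b f) 1)

/-- The operator `𝔸 = ∑_n 𝔸_n` on `S(𝔤)`, at `ħ = 1`; its composition with the restriction
`S(𝔤) → S(𝔭)` is `f ↦ f ⋆_L 1`. For each `f` only finitely many terms are nonzero, since `𝔸_n` lowers
the polynomial degree by `n`. -/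
def opA (b : Module.Basis (ι₁ ⊕ ι₂) 𝕜 𝔤) (f : SymmetricAlgebra 𝕜 𝔤) : SymmetricAlgebra 𝕜 𝔤 :=
  ∑ᶠ n, opATerm b n f

end Algebra

/-! ### Symmetric pairs -/

section SymmetricPair

variable {𝕜 𝔤 : Type*} [RCLike 𝕜] [LieRing 𝔤] [LieAlgebra 𝕜 𝔤]

/-- The `ε`-eigenspace of `σ`: `𝔨` for `ε = 1`, `𝔭` for `ε = -1`. -/
def eigenpart (σ : 𝔤 →ₗ⁅𝕜⁆ 𝔤) (ε : 𝕜) : Submodule 𝕜 𝔤 :=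
  Module.End.eigenspace (σ : 𝔤 →ₗ[𝕜] 𝔤) ε

theorem mem_eigenpart {σ : 𝔤 →ₗ⁅𝕜⁆ 𝔤} {ε : 𝕜} {x : 𝔤} : x ∈ eigenpart σ ε ↔ σ x = ε • x :=
  Module.End.mem_eigenspace_iff

/-- The restriction of `ad k`, `k ∈ 𝔨`, to `𝔨` (for `ε = 1`) and to `𝔭` (for `ε = -1`). -/
def adPart (σ : 𝔤 →ₗ⁅𝕜⁆ 𝔤) (ε : 𝕜) (k : eigenpart σ (1 : 𝕜)) :
    eigenpart σ ε →ₗ[𝕜] eigenpart σ ε :=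
  (LieAlgebra.ad 𝕜 𝔤 (k : 𝔤)).restrict fun x hx => by
    have hk := mem_eigenpart.mp k.2
    rw [mem_eigenpart] at hx ⊢
    rw [LieAlgebra.ad_apply, LieHom.map_lie, hk, hx, one_smul, lie_smul]

/-- The character `δ(k) = ½ tr_𝔭 (ad k)` of `𝔨`. -/
def delta (σ : 𝔤 →ₗ⁅𝕜⁆ 𝔤) (k : eigenpart σ (1 : 𝕜)) : 𝕜 :=
  1 / 2 * LinearMap.trace 𝕜 _ (adPart σ (-1) k)

end SymmetricPair

end Biquantization

end

noncomputable section

namespace Biquantization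

/-! ### Values of the propagators on the slice -/

section Propagators

open MeasureTheory Set

/-! The integral. On the slice the quotient is the upper half-plane, and with `q = √z` the unmarked
real point has root `i`. Since `d arg` of a conjugate is minus `d arg`, the four terms of `ω^{+,-}`
collapse to `π⁻¹ d arg ((q - i) / (q + i))`, while `2π η = arg q`. In polar coordinates `z = ρ
e^{iψ}` the form `dη` is `dψ / 4π`, so only the radial component of `ω^{+,-}` matters. That
component is `π⁻¹` times the `ρ`-derivative of `arctan ((√ρ - 1/√ρ) / (2 cos (ψ/2)))`, which
increases from `-π/2` to `π/2`. Every ray thus contributes `1`, and `η` has total variation `1/4`.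
The density has constant sign, so Tonelli gives convergence and value together
(`lintegral_upperDensity`); the sign `-1` of the density cancels against `orientationSign`.

The terms with `n ≥ 2`. Each edge differentiates once, and on a linear `f` with `h = 1` the input
has polynomial degree at most `n + 1`. The `2n` edges annihilate it as soon as `2n > n + 1`
(`graphOperator_linear_eq_zero`).

The term `n = 1`. Projection to functions forces both edges to depart from `z₁`, and the product of
two linear functions, one at `z₁` and one at `x₁`, survives only if each is differentiated once.
What remains is a short loop at `z₁` with an edge to `x₁`, in two orders that contribute equally and
absorb the factor `1 / 2!`. As `k` has only `𝔨`-coordinates, the edge always carries `ω^{+,-}`; the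
loop signs turn the sum over the loop index into `tr_𝔭 (ad k) - tr_𝔨 (ad k)`. -/

theorem qpos_real_slice {n : ℕ} (z : Fin n → ℂ) : qpos (Sum.inr 0) (slice z) = Complex.I := by
  have h : (-1 : ℂ) = ((-1 : ℝ) : ℂ) := by norm_num
  have h2 : (Real.pi : ℂ) * Complex.I * (1 / 2) = (Real.pi : ℂ) / 2 * Complex.I := by ring
  simp only [qpos, pos, slice, Sum.elim_inr, Matrix.cons_val_zero, Matrix.cons_val_one,
    Complex.ofReal_zero, sub_zero]
  rw [Complex.ofReal_cpow_of_nonpos (by norm_num)]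
  simp only [Complex.ofReal_neg, Complex.ofReal_one, neg_neg, Complex.one_cpow, one_mul]
  rw [h2, Complex.exp_pi_div_two_mul_I]

theorem hasFDerivAt_qpos_upper {n : ℕ} (z : Fin n → ℂ) (i : Fin n) (hz : 0 < (z i).im) :
    ∃ D : ConfCoord n →L[ℝ] ℂ, HasFDerivAt (qpos (Sum.inl i)) D (slice z) ∧
      ∀ h : Fin n → ℂ, D (h, 0) = (2 * (z i) ^ (1 / 2 : ℂ))⁻¹ * h i := by
  let L : ConfCoord n →L[ℝ] ℂ :=
    (ContinuousLinearMap.proj (R := ℝ) (φ := fun _ : Fin n => ℂ) i).comp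
      (ContinuousLinearMap.fst ℝ _ _) -
    Complex.ofRealCLM.comp ((ContinuousLinearMap.proj (R := ℝ) (φ := fun _ : Fin 2 => ℝ) 1).comp
      (ContinuousLinearMap.snd ℝ _ _))
  have h1 : HasFDerivAt (fun p : ConfCoord n => p.1 i - ((p.2 1 : ℝ) : ℂ)) L (slice z) :=
    L.hasFDerivAt
  have e : (fun p : ConfCoord n => p.1 i - ((p.2 1 : ℝ) : ℂ)) (slice z) = z i := by simp [slice]
  have hs : z i ∈ Complex.slitPlane := Or.inr hz.ne'
  have h2 : HasDerivAt (fun w : ℂ => w ^ (1 / 2 : ℂ)) (1 / 2 * (z i) ^ ((1 / 2 : ℂ) - 1) * 1) (z i) :=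
    (hasDerivAt_id (z i)).cpow_const hs
  refine ⟨_, h2.comp_hasFDerivAt_of_eq (slice z) h1 e.symm, fun h => ?_⟩
  have h3 : (z i) ^ ((1 / 2 : ℂ) - 1) = ((z i) ^ (1 / 2 : ℂ))⁻¹ := by
    rw [← Complex.cpow_neg]; norm_num
  simp [-one_div, h3, L]
  left
  ring

/-- The point `x₁ - x₂` lies on the branch cut of the power, so the complex chain rule is
unavailable. But it stays real and negative nearby, where the root is `i √(x₂ - x₁)`, a smooth
function of the real points alone; hence the zero derivative along the slice. -/
theorem hasFDerivAt_qpos_real {n : ℕ} (z : Fin n → ℂ) :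
    ∃ D : ConfCoord n →L[ℝ] ℂ, HasFDerivAt (qpos (Sum.inr 0)) D (slice z) ∧
      ∀ h : Fin n → ℂ, D (h, 0) = 0 := by
  let L : ConfCoord n →L[ℝ] ℝ :=
    (ContinuousLinearMap.proj (R := ℝ) (φ := fun _ : Fin 2 => ℝ) 1).comp
      (ContinuousLinearMap.snd ℝ _ _) -
    (ContinuousLinearMap.proj (R := ℝ) (φ := fun _ : Fin 2 => ℝ) 0).comp
      (ContinuousLinearMap.snd ℝ _ _)
  have h1 : HasFDerivAt (fun p : ConfCoord n => p.2 1 - p.2 0) L (slice z) :=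
    L.hasFDerivAt
  have e : (fun p : ConfCoord n => p.2 1 - p.2 0) (slice z) = 1 := by simp [slice]
  have h2 : HasDerivAt (fun t : ℝ => Complex.I * (Real.sqrt t : ℂ))
      (Complex.I * ((1 / (2 * Real.sqrt 1) : ℝ) : ℂ)) 1 :=
    ((Real.hasDerivAt_sqrt one_ne_zero).ofReal_comp).const_mul _
  have e' : (slice z).2 1 - (slice z).2 0 = 1 := e
  have h2' := h2.hasFDerivAt
  rw [← e'] at h2'
  have h3 := HasFDerivAt.comp (g := fun t : ℝ => Complex.I * (Real.sqrt t : ℂ)) (slice z)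
    h2' h1
  refine ⟨_, h3.congr_of_eventuallyEq ?_, fun h => ?_⟩
  · have : ∀ᶠ p in nhds (slice z), 0 < (fun p : ConfCoord n => p.2 1 - p.2 0) p :=
      h1.continuousAt.eventually (by rw [e]; exact lt_mem_nhds one_pos)
    filter_upwards [this] with p hp
    have e1 : ((p.2 0 : ℂ) - (p.2 1 : ℂ)) = ((p.2 0 - p.2 1 : ℝ) : ℂ) := by push_cast; ring
    have e2 : (Real.pi : ℂ) * Complex.I * (1 / 2) = (Real.pi : ℂ) / 2 * Complex.I := by ring
    have hp' : 0 ≤ p.2 1 - p.2 0 := le_of_lt hp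
    simp only [qpos, pos, Sum.elim_inr, Function.comp_def]
    rw [e1, Complex.ofReal_cpow_of_nonpos (by linarith), e2, Complex.exp_pi_div_two_mul_I,
      ← Complex.ofReal_neg, neg_sub, Real.sqrt_eq_rpow, Complex.ofReal_cpow hp']
    push_cast
    ring
  · simp [L]

theorem dArg_apply {n : ℕ} {h : ConfCoord n → ℂ} {p : ConfCoord n} {D : ConfCoord n →L[ℝ] ℂ}
    (hD : HasFDerivAt h D p) (u : ConfCoord n) : dArg h p u = ((h p)⁻¹ * D u).im := by
  simp [dArg, hD.fderiv]

theorem qpos_upper_slice {n : ℕ} (z : Fin n → ℂ) (i : Fin n) :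
    qpos (Sum.inl i) (slice z) = (z i) ^ (1 / 2 : ℂ) := by
  simp [qpos, pos, slice]

/-- The square root of a point of the upper half-plane lies in the open first quadrant. -/
theorem cpow_half_quadrant {w : ℂ} (hw : 0 < w.im) :
    0 < (w ^ (1 / 2 : ℂ)).re ∧ 0 < (w ^ (1 / 2 : ℂ)).im := by
  have hw0 : w ≠ 0 := by rintro rfl; simp at hw
  have hn : 0 < ‖w‖ := norm_pos_iff.mpr hw0
  have ha : 0 < w.arg := by
    refine lt_of_le_of_ne (Complex.arg_nonneg_iff.mpr hw.le) fun h => ?_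
    have := (Complex.arg_eq_zero_iff.mp h.symm).2
    exact hw.ne' this
  have hb : w.arg < Real.pi := by
    refine lt_of_le_of_ne (Complex.arg_le_pi w) fun h => ?_
    exact hw.ne' (Complex.arg_eq_pi_iff.mp h).2
  have e : w ^ (1 / 2 : ℂ) = Complex.exp ((((Real.log ‖w‖) / 2 : ℝ) : ℂ) + ((w.arg / 2 : ℝ) : ℂ) * Complex.I) := by
    rw [Complex.cpow_def_of_ne_zero hw0, Complex.log]
    congr 1
    push_cast
    ring
  rw [e, Complex.exp_re, Complex.exp_im]
  simp only [Complex.add_re, Complex.add_im, Complex.ofReal_re, Complex.ofReal_im, Complex.mul_re,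
    Complex.mul_im, Complex.I_re, Complex.I_im, mul_zero, mul_one, sub_self, add_zero, zero_add]
  exact ⟨mul_pos (Real.exp_pos _) (Real.cos_pos_of_mem_Ioo ⟨by linarith, by linarith⟩),
    mul_pos (Real.exp_pos _) (Real.sin_pos_of_pos_of_lt_pi (by linarith) (by linarith))⟩

theorem dEta_slice {n : ℕ} (z : Fin n → ℂ) (i : Fin n) (hz : 0 < (z i).im) (h : Fin n → ℂ) :
    dEta (Sum.inl i) (slice z) (h, 0) =
      (2 * Real.pi)⁻¹ * ((2 * ((z i) ^ (1 / 2 : ℂ)) ^ 2)⁻¹ * h i).im := by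
  obtain ⟨D, hD, hDv⟩ := hasFDerivAt_qpos_upper z i hz
  have hq := qpos_upper_slice z i
  have hs : qpos (Sum.inl i) (slice z) ∈ Complex.slitPlane := by
    rw [hq]; exact Or.inl (cpow_half_quadrant hz).1
  have h1 : HasFDerivAt (fun p => Complex.log (qpos (Sum.inl i) p)) _ (slice z) :=
    (Complex.hasDerivAt_log hs).comp_hasFDerivAt (slice z) hD
  have h2 := (Complex.imCLM.hasFDerivAt.comp (slice z) h1).const_mul (2 * Real.pi)⁻¹
  have h3 : HasFDerivAt (eta (Sum.inl i)) _ (slice z) := h2.congr_of_eventuallyEq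
    (Filter.Eventually.of_forall fun p => by
      simp [eta, Complex.log_im, div_eq_inv_mul])
  rw [dEta, h3.fderiv, hq]
  have e : (2 * ((z i) ^ (1 / 2 : ℂ)) ^ 2)⁻¹ * h i =
      ((z i) ^ (1 / 2 : ℂ))⁻¹ * ((2 * (z i) ^ (1 / 2 : ℂ))⁻¹ * h i) := by
    rw [mul_inv, mul_inv]
    ring
  rw [e, ← hDv]
  rfl

/-- Conjugation makes the four terms equal in pairs, leaving twice `d arg (q - i) - d arg (q + i)`.
Partial fractions and `dq = dz / (2q)` give the closed form. -/
theorem omega_slice {n : ℕ} (z : Fin n → ℂ) (i : Fin n) (hz : 0 < (z i).im) (h : Fin n → ℂ) :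
    omega 1 (-1) (Sum.inl i) (Sum.inr 0) (slice z) (h, 0) =
      Real.pi⁻¹ * (Complex.I * ((z i) ^ (1 / 2 : ℂ) * (((z i) ^ (1 / 2 : ℂ)) ^ 2 + 1))⁻¹ * h i).im := by
  obtain ⟨D, hD, hDv⟩ := hasFDerivAt_qpos_upper z i hz
  obtain ⟨E, hE, hEv⟩ := hasFDerivAt_qpos_real z
  have hq := qpos_upper_slice z i
  have hI := qpos_real_slice z
  obtain ⟨hr, hi⟩ := cpow_half_quadrant hz
  set q := (z i) ^ (1 / 2 : ℂ) with hqdef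
  have hc : HasFDerivAt (fun p => (starRingEnd ℂ) (qpos (Sum.inl i) p)) _ (slice z) :=
    (Complex.conjCLE : ℂ →L[ℝ] ℂ).hasFDerivAt.comp (slice z) hD
  rw [omega]
  simp only [smul_apply, add_apply,
    sub_apply]
  rw [dArg_apply (hD.fun_sub hE), dArg_apply (hc.fun_sub hE), dArg_apply (hc.fun_add hE),
    dArg_apply (hD.fun_add hE), hq, hI]
  simp only [sub_apply, add_apply, hEv, hDv,
    ContinuousLinearMap.comp_apply, sub_zero, add_zero]
  have e1 : (((starRingEnd ℂ) q - Complex.I)⁻¹ * ((Complex.conjCLE : ℂ →L[ℝ] ℂ) ((2 * q)⁻¹ * h i))).im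
      = - ((q + Complex.I)⁻¹ * ((2 * q)⁻¹ * h i)).im := by
    rw [← Complex.conj_im]
    simp [sub_eq_add_neg]
  have e2 : (((starRingEnd ℂ) q + Complex.I)⁻¹ * ((Complex.conjCLE : ℂ →L[ℝ] ℂ) ((2 * q)⁻¹ * h i))).im
      = - ((q - Complex.I)⁻¹ * ((2 * q)⁻¹ * h i)).im := by
    rw [← Complex.conj_im]
    simp [sub_eq_add_neg]
  rw [e1, e2]
  have n0 : q ≠ 0 := fun h => by rw [h] at hr; simp at hr
  have n1 : q - Complex.I ≠ 0 := fun h => by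
    have := congrArg Complex.re h; simp at this; exact hr.ne' this
  have n2 : q + Complex.I ≠ 0 := fun h => by
    have := congrArg Complex.re h; simp at this; exact hr.ne' this
  have n3 : q ^ 2 + 1 = (q - Complex.I) * (q + Complex.I) := by
    linear_combination Complex.I_sq
  have e3 : (Complex.I * (q * (q ^ 2 + 1))⁻¹ * h i).im =
      ((q - Complex.I)⁻¹ * ((2 * q)⁻¹ * h i)).im - ((q + Complex.I)⁻¹ * ((2 * q)⁻¹ * h i)).im := by
    rw [← Complex.sub_im, n3]
    congr 1
    field_simp
    ring
  rw [e3]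
  simp
  field_simp
  ring

theorem mem_sliceDomain_one {z : Fin 1 → ℂ} : z ∈ sliceDomain 1 ↔ 0 < (z 0).im := by
  simp [sliceDomain, Conf, slice, Function.injective_of_subsingleton]

/-- The integrand `dη ∧ ω^{+,-}` in the coordinate of the upper half-plane. -/
theorem density_loopForms {z : Fin 1 → ℂ} (hz : 0 < (z 0).im) :
    density loopForms z =
      -((4 * Real.pi ^ 2)⁻¹ * (((z 0) ^ (1 / 2 : ℂ) / (z 0 + 1)).re / ‖z 0‖ ^ 2)) := by
  have f0 : frame 1 0 = (fun _ => 1, 0) := by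
    have : (finProdFinEquiv.symm (0 : Fin (1 * 2))) = ((0, 0) : Fin 1 × Fin 2) := by decide
    rw [frame, this]
    refine Prod.ext (funext fun i => ?_) rfl
    simp [Subsingleton.elim i 0]
  have f1 : frame 1 1 = (fun _ => Complex.I, 0) := by
    have : (finProdFinEquiv.symm (1 : Fin (1 * 2))) = ((0, 1) : Fin 1 × Fin 2) := by decide
    rw [frame, this]
    refine Prod.ext (funext fun i => ?_) rfl
    simp [Subsingleton.elim i 0]
  have hd : density loopForms z =
      loopForms 0 (slice z) (frame 1 0) * loopForms 1 (slice z) (frame 1 1) -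
      loopForms 0 (slice z) (frame 1 1) * loopForms 1 (slice z) (frame 1 0) :=
    Matrix.det_fin_two _
  have l0 : loopForms 0 = dEta (Sum.inl 0) := rfl
  have l1 : loopForms 1 = omega 1 (-1) (Sum.inl 0) (Sum.inr 0) := rfl
  rw [hd, l0, l1, f0, f1, dEta_slice z 0 hz, dEta_slice z 0 hz, omega_slice z 0 hz,
    omega_slice z 0 hz]
  have hq2 : ((z 0) ^ (1 / 2 : ℂ)) ^ 2 = z 0 := by
    rw [← Complex.cpow_nat_mul]; norm_num
  have n0 : (z 0) ^ (1 / 2 : ℂ) ≠ 0 := fun h => by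
    have := (cpow_half_quadrant hz).1; rw [h] at this; simp at this
  have n1 : z 0 + 1 ≠ 0 := fun h => by
    have := congrArg Complex.im h; simp at this; exact hz.ne' this
  rw [hq2]
  -- For `a = Im (A dz)` and `b = Im (B dz)` the value of `a ∧ b` on the frame `(1, i)` is `-Im
  -- (conj A * B)`. The right side has this shape, with `A` and `B` the coefficients of `dη` and
  -- `ω^{+,-}` up to real factors.
  have key : ((z 0) ^ (1 / 2 : ℂ) / (z 0 + 1)).re / ‖z 0‖ ^ 2 =
      ((starRingEnd ℂ) (z 0)⁻¹ * (Complex.I * ((z 0) ^ (1 / 2 : ℂ) * (z 0 + 1))⁻¹)).im := by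
    have e : (starRingEnd ℂ) (z 0)⁻¹ * (Complex.I * ((z 0) ^ (1 / 2 : ℂ) * (z 0 + 1))⁻¹) =
        (((‖z 0‖ ^ 2)⁻¹ : ℝ) : ℂ) * (Complex.I * ((z 0) ^ (1 / 2 : ℂ) / (z 0 + 1))) := by
      have : (starRingEnd ℂ) (z 0)⁻¹ = z 0 * (((‖z 0‖ ^ 2)⁻¹ : ℝ) : ℂ) := by
        rw [Complex.inv_def, map_mul, Complex.conj_conj, Complex.conj_ofReal,
          Complex.normSq_eq_norm_sq]
      rw [this]
      nth_rw 1 [← hq2]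
      field_simp
    rw [e, Complex.im_ofReal_mul, Complex.I_mul_im]
    ring
  rw [key]
  generalize Complex.I * ((z 0) ^ (1 / 2 : ℂ) * (z 0 + 1))⁻¹ = B
  have : (2 * z 0)⁻¹ = ((1 / 2 : ℝ) : ℂ) * (z 0)⁻¹ := by rw [mul_inv]; push_cast; ring
  rw [this]
  generalize (z 0)⁻¹ = A
  simp [-one_div]
  field_simp
  ring

end Propagators

/-! ### The integral of `dη ∧ ω^{+,-}` -/

section Integral

open MeasureTheory Set

/-- The angular function whose radial derivative is the density of `dη ∧ ω^{+,-}` in polar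
coordinates. -/
def angleFun (c ρ : ℝ) : ℝ := Real.arctan ((√ρ - (√ρ)⁻¹) / (2 * c))

theorem hasDerivAt_angleFun {c ρ : ℝ} (hc : 0 < c) (hρ : 0 < ρ) :
    HasDerivAt (angleFun c) (c * (√ρ + (√ρ)⁻¹) / (ρ * ((√ρ - (√ρ)⁻¹) ^ 2 + 4 * c ^ 2))) ρ := by
  have hs := Real.hasDerivAt_sqrt hρ.ne'
  have hr : 0 < √ρ := Real.sqrt_pos.mpr hρ
  have h := ((hs.fun_sub (hs.fun_inv hr.ne')).div_const (2 * c)).arctan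
  refine h.congr_deriv ?_
  have hsq : ρ = √ρ ^ 2 := (Real.sq_sqrt hρ.le).symm
  set r := √ρ
  rw [hsq]
  have : (0 : ℝ) < (r - r⁻¹) ^ 2 + 4 * c ^ 2 := by positivity
  have e : 1 + ((r - r⁻¹) / (2 * c)) ^ 2 = ((r - r⁻¹) ^ 2 + 4 * c ^ 2) / (4 * c ^ 2) := by
    field_simp
    ring
  rw [e]
  field_simp
  ring

/-- The map `r ↦ r - 1/r` carries the positive half-line onto the whole line, so nothing of the
range of `arctan` is lost. -/
theorem angleFun_image {c : ℝ} (hc : 0 < c) :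
    angleFun c '' Ioi 0 = Ioo (-(Real.pi / 2)) (Real.pi / 2) := by
  rw [← Real.range_arctan]
  ext y
  constructor
  · rintro ⟨ρ, -, rfl⟩
    exact ⟨_, rfl⟩
  · rintro ⟨t, rfl⟩
    have hpos : 0 < c * t + √((c * t) ^ 2 + 1) := by
      have : |c * t| < √((c * t) ^ 2 + 1) := by
        rw [← Real.sqrt_sq_eq_abs]
        exact Real.sqrt_lt_sqrt (sq_nonneg _) (by linarith)
      linarith [neg_abs_le (c * t)]
    -- The square of the positive root of `r ^ 2 - 2 c t r - 1 = 0`, that is, of `r - 1/r = 2 c t`.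
    refine ⟨(c * t + √((c * t) ^ 2 + 1)) ^ 2, pow_pos hpos 2, ?_⟩
    rw [angleFun, Real.sqrt_sq hpos.le]
    congr 1
    have h := Real.sq_sqrt (show 0 ≤ (c * t) ^ 2 + 1 by positivity)
    set s := √((c * t) ^ 2 + 1)
    rw [div_eq_iff (by positivity)]
    field_simp
    nlinarith

/-- The integrand is the derivative of the monotone `angleFun c`, so its integral is the length of
the image. No integrability has to be known beforehand. -/
theorem lintegral_radial {c : ℝ} (hc : 0 < c) :
    ∫⁻ ρ in Ioi (0 : ℝ), ENNReal.ofReal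
      (c * (√ρ + (√ρ)⁻¹) / (ρ * ((√ρ - (√ρ)⁻¹) ^ 2 + 4 * c ^ 2))) = ENNReal.ofReal Real.pi := by
  rw [lintegral_deriv_eq_volume_image_of_monotoneOn measurableSet_Ioi
    (fun ρ hρ => (hasDerivAt_angleFun hc hρ).hasDerivWithinAt), angleFun_image hc, Real.volume_Ioo]
  · ring_nf
  · intro a ha b hb hab
    refine Real.arctan_strictMono.monotone ?_
    have h1 : √a ≤ √b := Real.sqrt_le_sqrt hab
    have h2 : (√b)⁻¹ ≤ (√a)⁻¹ := inv_anti₀ (Real.sqrt_pos.mpr ha) h1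
    exact div_le_div_of_nonneg_right (by linarith) (by positivity)

/-- The opposite of the density of `dη ∧ ω^{+,-}` on the upper half-plane. -/
def upperDensity (w : ℂ) : ℝ :=
  (4 * Real.pi ^ 2)⁻¹ * ((w ^ (1 / 2 : ℂ) / (w + 1)).re / ‖w‖ ^ 2)

theorem measurable_upperDensity : Measurable upperDensity := by
  unfold upperDensity
  have h : Measurable fun w : ℂ => w ^ (1 / 2 : ℂ) := measurable_id.pow_const _
  fun_prop

theorem polar_half_pow {ρ ψ : ℝ} (hρ : 0 < ρ) (hψ : ψ ∈ Ioo (-Real.pi) Real.pi) :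
    (Complex.polarCoord.symm (ρ, ψ)) ^ (1 / 2 : ℂ) =
      (√ρ : ℂ) * (Real.cos (ψ / 2) + Real.sin (ψ / 2) * Complex.I) := by
  have e : Complex.polarCoord.symm (ρ, ψ) = Complex.exp ((Real.log ρ : ℂ) + ψ * Complex.I) := by
    rw [Complex.polarCoord_symm_apply, Complex.exp_add, Complex.exp_mul_I, ← Complex.ofReal_exp,
      Real.exp_log hρ]
    push_cast
    rfl
  have e1 : ((Real.log ρ : ℂ) + ψ * Complex.I) * (1 / 2) =
      ((Real.log ρ / 2 : ℝ) : ℂ) + ((ψ / 2 : ℝ) : ℂ) * Complex.I := by push_cast; ring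
  rw [e, Complex.cpow_def_of_ne_zero (Complex.exp_ne_zero _), Complex.log_exp (by simpa using hψ.1)
    (by simpa using hψ.2.le), e1, Complex.exp_add, Complex.exp_mul_I, ← Complex.ofReal_exp,
    ← Complex.ofReal_cos, ← Complex.ofReal_sin, Real.sqrt_eq_rpow, Real.rpow_def_of_pos hρ]
  ring_nf

theorem upperDensity_polar {ρ ψ : ℝ} (hρ : 0 < ρ) (hψ : ψ ∈ Ioo (-Real.pi) Real.pi) :
    ρ * upperDensity (Complex.polarCoord.symm (ρ, ψ)) =
      (4 * Real.pi ^ 2)⁻¹ * (Real.cos (ψ / 2) * (√ρ + (√ρ)⁻¹) /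
        (ρ * ((√ρ - (√ρ)⁻¹) ^ 2 + 4 * Real.cos (ψ / 2) ^ 2))) := by
  have hc : 0 < Real.cos (ψ / 2) :=
    Real.cos_pos_of_mem_Ioo ⟨by linarith [hψ.1], by linarith [hψ.2]⟩
  have hr : 0 < √ρ := Real.sqrt_pos.mpr hρ
  have hsq : ρ = √ρ ^ 2 := (Real.sq_sqrt hρ.le).symm
  have hw := polar_half_pow hρ hψ
  set w := Complex.polarCoord.symm (ρ, ψ) with hwdef
  have hn : ‖w‖ = ρ := by rw [hwdef, Complex.norm_polarCoord_symm, abs_of_pos hρ]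
  have hw2 : w = (w ^ (1 / 2 : ℂ)) ^ 2 := by
    rw [← Complex.cpow_nat_mul]; norm_num
  have hcs := Real.sin_sq_add_cos_sq (ψ / 2)
  rw [upperDensity, hn]
  nth_rw 2 [hw2]
  rw [hw]
  set r := √ρ
  set c := Real.cos (ψ / 2)
  set s := Real.sin (ψ / 2)
  -- This is the real part of `1 / (q + q⁻¹)`: there `Re (q + q⁻¹) = c (r + r⁻¹)`, and `|q + q⁻¹|² =
  -- (r - r⁻¹)² + 4 c²`.
  have hre : ((r : ℂ) * (c + s * Complex.I) / (((r : ℂ) * (c + s * Complex.I)) ^ 2 + 1)).re =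
      c * (r + r⁻¹) / ((r - r⁻¹) ^ 2 + 4 * c ^ 2) := by
    have hD : (0 : ℝ) < (r - r⁻¹) ^ 2 + 4 * c ^ 2 := by positivity
    have e : (((r : ℂ) * (c + s * Complex.I)) ^ 2 + 1) =
        ((r ^ 2 * (c ^ 2 - s ^ 2) + 1 : ℝ) : ℂ) + ((2 * r ^ 2 * c * s : ℝ) : ℂ) * Complex.I := by
      push_cast
      linear_combination (r : ℂ) ^ 2 * s ^ 2 * Complex.I_sq
    have hN : (r ^ 2 * (c ^ 2 - s ^ 2) + 1) ^ 2 + (2 * r ^ 2 * c * s) ^ 2 =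
        r ^ 2 * ((r - r⁻¹) ^ 2 + 4 * c ^ 2) := by
      have hs2 : s ^ 2 = 1 - c ^ 2 := by linarith
      have e4 : (2 * r ^ 2 * c * s) ^ 2 = 4 * r ^ 4 * c ^ 2 * s ^ 2 := by ring
      rw [e4, hs2]
      field_simp
      ring
    rw [e, Complex.div_re]
    have hnorm : Complex.normSq (((r ^ 2 * (c ^ 2 - s ^ 2) + 1 : ℝ) : ℂ) +
        ((2 * r ^ 2 * c * s : ℝ) : ℂ) * Complex.I) = r ^ 2 * ((r - r⁻¹) ^ 2 + 4 * c ^ 2) := by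
      rw [Complex.normSq_add_mul_I, hN]
    rw [hnorm, ← add_div]
    simp only [Complex.add_re, Complex.add_im, Complex.ofReal_re, Complex.ofReal_im, Complex.mul_re,
      Complex.mul_im, Complex.I_re, Complex.I_im, mul_zero, mul_one, sub_self, add_zero, zero_add,
      zero_mul, sub_zero]
    have hs2 : s ^ 2 = 1 - c ^ 2 := by linarith
    rw [div_eq_div_iff (by positivity) hD.ne']
    have : r * c * (r ^ 2 * (c ^ 2 - s ^ 2) + 1) + r * s * (2 * r ^ 2 * c * s) =
        r ^ 2 * (c * (r + r⁻¹)) := by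
      have : r ^ 2 * (c * (r + r⁻¹)) = c * (r ^ 3 + r) := by field_simp
      rw [this]
      linear_combination r ^ 3 * c * hcs
    rw [this]
    ring
  rw [hre]
  field_simp

/-- Tonelli in polar coordinates: each ray with angle in `(0, π)` gives `π / (4 π²)` independently
of the angle, and the remaining rays miss the upper half-plane. -/
theorem lintegral_upperDensity :
    ∫⁻ w in {w : ℂ | 0 < w.im}, ENNReal.ofReal (upperDensity w) = ENNReal.ofReal (1 / 4) := by
  have hH : MeasurableSet {w : ℂ | 0 < w.im} := measurableSet_lt measurable_const Complex.measurable_im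
  rw [← lintegral_indicator hH, ← Complex.lintegral_comp_polarCoord_symm]
  set f : ℂ → ENNReal := indicator {w : ℂ | 0 < w.im} fun w => ENNReal.ofReal (upperDensity w) with hf
  have hfm : Measurable f := (measurable_upperDensity.ennreal_ofReal).indicator hH
  have hpm : Measurable Complex.polarCoord.symm := by
    have : (Complex.polarCoord.symm : ℝ × ℝ → ℂ) =
        fun p => (p.1 : ℂ) * (Real.cos p.2 + Real.sin p.2 * Complex.I) := by
      funext p; exact Complex.polarCoord_symm_apply p
    rw [this]
    fun_prop
  have htarget : polarCoord.target = Ioi (0 : ℝ) ×ˢ Ioo (-Real.pi) Real.pi := rfl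
  have hin : ∀ ψ ∈ Ioo (-Real.pi) Real.pi,
      ∫⁻ ρ in Ioi (0 : ℝ), ENNReal.ofReal ρ • f (Complex.polarCoord.symm (ρ, ψ)) =
        (Ioo 0 Real.pi).indicator (fun _ => ENNReal.ofReal ((4 * Real.pi)⁻¹)) ψ := by
    intro ψ hψ
    have him : ∀ ρ : ℝ, (Complex.polarCoord.symm (ρ, ψ)).im = ρ * Real.sin ψ := by
      intro ρ
      simp [Complex.polarCoord_symm_apply, -Complex.ofReal_cos, -Complex.ofReal_sin]
    by_cases h0 : 0 < ψ
    · have hsin : 0 < Real.sin ψ := Real.sin_pos_of_pos_of_lt_pi h0 hψ.2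
      have hc : 0 < Real.cos (ψ / 2) :=
        Real.cos_pos_of_mem_Ioo ⟨by linarith [hψ.1], by linarith [hψ.2]⟩
      rw [indicator_of_mem (show ψ ∈ Ioo 0 Real.pi from ⟨h0, hψ.2⟩)]
      have : ∀ ρ ∈ Ioi (0 : ℝ), ENNReal.ofReal ρ • f (Complex.polarCoord.symm (ρ, ψ)) =
          ENNReal.ofReal ((4 * Real.pi ^ 2)⁻¹) * ENNReal.ofReal (Real.cos (ψ / 2) * (√ρ + (√ρ)⁻¹) /
            (ρ * ((√ρ - (√ρ)⁻¹) ^ 2 + 4 * Real.cos (ψ / 2) ^ 2))) := by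
        intro ρ hρ
        have hm : Complex.polarCoord.symm (ρ, ψ) ∈ {w : ℂ | 0 < w.im} := by
          rw [mem_ofPred_eq, him]; exact mul_pos hρ hsin
        rw [hf, indicator_of_mem hm, smul_eq_mul, ← ENNReal.ofReal_mul (le_of_lt hρ),
          upperDensity_polar hρ hψ, ENNReal.ofReal_mul (by positivity)]
      rw [setLIntegral_congr_fun measurableSet_Ioi this, lintegral_const_mul' _ _ ENNReal.ofReal_ne_top,
        lintegral_radial hc, ← ENNReal.ofReal_mul (by positivity)]
      congr 1
      field_simp
    · have hsin : Real.sin ψ ≤ 0 := Real.sin_nonpos_of_nonpos_of_neg_pi_le (not_lt.mp h0) hψ.1.le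
      rw [indicator_of_notMem (fun h => h0 h.1)]
      have : ∀ ρ ∈ Ioi (0 : ℝ), ENNReal.ofReal ρ • f (Complex.polarCoord.symm (ρ, ψ)) = 0 := by
        intro ρ hρ
        have hm : Complex.polarCoord.symm (ρ, ψ) ∉ {w : ℂ | 0 < w.im} := by
          rw [mem_ofPred_eq, him, not_lt]
          exact mul_nonpos_of_nonneg_of_nonpos (le_of_lt hρ) hsin
        rw [hf, indicator_of_notMem hm, smul_zero]
      rw [setLIntegral_congr_fun measurableSet_Ioi this, lintegral_zero]
  -- The symmetric form of Tonelli makes the radial integral the inner one.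
  rw [htarget, Measure.volume_eq_prod, ← Measure.prod_restrict, lintegral_prod_symm _
    (by
      refine Measurable.aemeasurable ?_
      exact (measurable_fst.ennreal_ofReal).mul (hfm.comp hpm)),
    setLIntegral_congr_fun measurableSet_Ioo hin, lintegral_indicator measurableSet_Ioo,
    Measure.restrict_restrict measurableSet_Ioo, lintegral_const, Measure.restrict_apply_univ]
  have : Ioo 0 Real.pi ∩ Ioo (-Real.pi) Real.pi = Ioo 0 Real.pi :=
    inter_eq_left.mpr (Ioo_subset_Ioo_left (by linarith [Real.pi_pos]))
  rw [this, Real.volume_Ioo, ← ENNReal.ofReal_mul (by positivity)]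
  congr 1
  field_simp
  ring

/-- With `q = √w`, the numerator of `Re (q / (q ^ 2 + 1))` is `Re q * (|q| ^ 2 + 1)`, and `q` lies
in the first quadrant. -/
theorem upperDensity_nonneg {w : ℂ} (hw : 0 < w.im) : 0 ≤ upperDensity w := by
  obtain ⟨hr, hi⟩ := cpow_half_quadrant hw
  have hw2 : w = (w ^ (1 / 2 : ℂ)) ^ 2 := by
    rw [← Complex.cpow_nat_mul]; norm_num
  have : 0 ≤ (w ^ (1 / 2 : ℂ) / (w + 1)).re := by
    rw [Complex.div_re, ← add_div]
    refine div_nonneg ?_ (Complex.normSq_nonneg _)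
    have e1 : (w + 1).re = (w ^ (1 / 2 : ℂ)).re ^ 2 - (w ^ (1 / 2 : ℂ)).im ^ 2 + 1 := by
      nth_rw 1 [hw2]
      simp [pow_two]
    have e2 : (w + 1).im = 2 * (w ^ (1 / 2 : ℂ)).re * (w ^ (1 / 2 : ℂ)).im := by
      nth_rw 1 [hw2]
      simp [pow_two]
      ring
    rw [e1, e2]
    have : (w ^ (1 / 2 : ℂ)).re * ((w ^ (1 / 2 : ℂ)).re ^ 2 - (w ^ (1 / 2 : ℂ)).im ^ 2 + 1) +
        (w ^ (1 / 2 : ℂ)).im * (2 * (w ^ (1 / 2 : ℂ)).re * (w ^ (1 / 2 : ℂ)).im) =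
        (w ^ (1 / 2 : ℂ)).re * ((w ^ (1 / 2 : ℂ)).re ^ 2 + (w ^ (1 / 2 : ℂ)).im ^ 2 + 1) := by ring
    rw [this]
    positivity
  unfold upperDensity
  positivity

theorem integrableOn_upperDensity : IntegrableOn upperDensity {w : ℂ | 0 < w.im} := by
  have hH : MeasurableSet {w : ℂ | 0 < w.im} := measurableSet_lt measurable_const Complex.measurable_im
  refine ⟨measurable_upperDensity.aestronglyMeasurable, ?_⟩
  rw [hasFiniteIntegral_iff_ofReal, lintegral_upperDensity]
  · exact ENNReal.ofReal_lt_top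
  · exact (ae_restrict_iff' hH).mpr (Filter.Eventually.of_forall fun w hw => upperDensity_nonneg hw)

theorem integral_upperDensity : ∫ w in {w : ℂ | 0 < w.im}, upperDensity w = 1 / 4 := by
  have hH : MeasurableSet {w : ℂ | 0 < w.im} := measurableSet_lt measurable_const Complex.measurable_im
  rw [integral_eq_lintegral_of_nonneg_ae
    ((ae_restrict_iff' hH).mpr (Filter.Eventually.of_forall fun w hw => upperDensity_nonneg hw))
    measurable_upperDensity.aestronglyMeasurable, lintegral_upperDensity,
    ENNReal.toReal_ofReal (by norm_num)]

/-! ### Transfer from the upper half-plane to the configuration spaces -/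

theorem sliceDomain_one_eq :
    sliceDomain 1 = MeasurableEquiv.funUnique (Fin 1) ℂ ⁻¹' {w : ℂ | 0 < w.im} := by
  ext z
  exact mem_sliceDomain_one

theorem measurableSet_sliceDomain_one : MeasurableSet (sliceDomain 1) := by
  rw [sliceDomain_one_eq]
  exact (MeasurableEquiv.measurable _)
    (measurableSet_lt measurable_const Complex.measurable_im)

theorem density_loopForms_eqOn :
    EqOn (density loopForms) (fun z => -upperDensity (MeasurableEquiv.funUnique (Fin 1) ℂ z))
      (sliceDomain 1) :=
  fun _ hz => density_loopForms (mem_sliceDomain_one.mp hz)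

theorem confIntegrable_loopForms : ConfIntegrable loopForms := by
  have h := (volume_preserving_funUnique (Fin 1) ℂ).integrableOn_comp_preimage
    (MeasurableEquiv.measurableEmbedding _) |>.mpr integrableOn_upperDensity
  rw [← sliceDomain_one_eq] at h
  exact (integrableOn_congr_fun density_loopForms_eqOn measurableSet_sliceDomain_one).mpr h.neg

theorem orientationSign_eq : orientationSign = -1 := by
  simp [orientationSign, Matrix.det_fin_two]

theorem confIntegral_loopForms : confIntegral loopForms = 1 / 4 := by
  have h : ∫ z in sliceDomain 1, upperDensity (MeasurableEquiv.funUnique (Fin 1) ℂ z) = 1 / 4 := by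
    rw [← integral_upperDensity, sliceDomain_one_eq]
    exact (volume_preserving_funUnique (Fin 1) ℂ).setIntegral_preimage_emb
      (MeasurableEquiv.measurableEmbedding _) upperDensity {w : ℂ | 0 < w.im}
  rw [confIntegral, orientationSign_eq,
    setIntegral_congr_fun measurableSet_sliceDomain_one density_loopForms_eqOn, integral_neg, h]
  norm_num

/-- The slice is a point of volume one and the empty determinant is one, so only the orientation
sign is left. It is the normalizing denominator of `weight`. -/
theorem confIntegral_zero (α : Fin (0 * 2) → OneForm 0) : confIntegral α = -1 := by
  have hs : sliceDomain 0 = univ := by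
    ext z
    simp [sliceDomain, Conf, slice, Function.injective_of_subsingleton]
  have hd : density α = fun _ => 1 := by
    funext z
    exact Matrix.det_isEmpty (n := Fin 0)
  rw [confIntegral, orientationSign_eq, hs, hd]
  simp [Measure.real, volume_pi]

end Integral

/-! ### Degree considerations -/

section Degree

variable {𝕜 : Type*} [RCLike 𝕜] {V ι : Type*}

theorem totalDegree_pderiv_le {R σ : Type*} [CommSemiring R] (i : σ) (P : MvPolynomial σ R) :
    (MvPolynomial.pderiv i P).totalDegree ≤ P.totalDegree - 1 := by
  classical
  conv_lhs => rw [P.as_sum]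
  rw [map_sum]
  refine MvPolynomial.totalDegree_finsetSum_le fun s hs => ?_
  rw [MvPolynomial.pderiv_monomial]
  by_cases h : s i = 0
  · simp [h]
  · refine (MvPolynomial.totalDegree_monomial_le _ _).trans ?_
    have h1 : s - Finsupp.single i 1 + Finsupp.single i 1 = s :=
      tsub_add_cancel_of_le (Finsupp.single_le_iff.mpr (Nat.one_le_iff_ne_zero.mpr h))
    have h2 : (s - Finsupp.single i 1).degree + 1 = s.degree := by
      conv_rhs => rw [← h1, map_add, Finsupp.degree_single]
    have h3 : s.degree ≤ P.totalDegree := MvPolynomial.le_totalDegree hs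
    change (s - Finsupp.single i 1).degree ≤ _
    omega

variable (𝕜 V ι) in
/-- Polyvector fields with polynomial coefficients of degree less than `d`. -/
def degreeLT (d : ℕ) : Submodule 𝕜 (TPoly 𝕜 V ι) :=
  Submodule.span 𝕜 {t | ∃ P ω, P.totalDegree < d ∧ t = P ⊗ₜ[𝕜] ω}

theorem tmul_mem_degreeLT {d : ℕ} {P : MvPolynomial (V × ι) 𝕜} (hP : P.totalDegree < d)
    (ω : ExteriorAlgebra 𝕜 ((V × ι) → 𝕜)) : P ⊗ₜ[𝕜] ω ∈ degreeLT 𝕜 V ι d :=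
  Submodule.subset_span ⟨P, ω, hP, rfl⟩

theorem degreeLT_mono {d e : ℕ} (h : d ≤ e) : degreeLT 𝕜 V ι d ≤ degreeLT 𝕜 V ι e :=
  Submodule.span_mono fun _ ⟨P, ω, hP, ht⟩ => ⟨P, ω, hP.trans_le h, ht⟩

theorem degreeLT_zero : degreeLT 𝕜 V ι 0 = ⊥ := by
  simp [degreeLT]

theorem mul_mem_degreeLT {d e : ℕ} {s t : TPoly 𝕜 V ι} (hs : s ∈ degreeLT 𝕜 V ι (d + 1))
    (ht : t ∈ degreeLT 𝕜 V ι (e + 1)) : s * t ∈ degreeLT 𝕜 V ι (d + e + 1) := by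
  have h := Submodule.mul_mem_mul hs ht
  rw [degreeLT, degreeLT, Submodule.span_mul_span] at h
  refine Submodule.span_le.mpr ?_ h
  rintro _ ⟨_, ⟨P, ω, hP, rfl⟩, _, ⟨Q, θ, hQ, rfl⟩, rfl⟩
  have := MvPolynomial.totalDegree_mul P Q
  simp only [Algebra.TensorProduct.tmul_mul_tmul]
  exact tmul_mem_degreeLT (by omega) _

theorem tau_mem_degreeLT {d : ℕ} {t : TPoly 𝕜 V ι} (v w : V) (i : ι)
    (ht : t ∈ degreeLT 𝕜 V ι (d + 1)) : tau 𝕜 v w i t ∈ degreeLT 𝕜 V ι d := by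
  rw [← Submodule.mem_comap]
  refine Submodule.span_le.mpr ?_ ht
  rintro _ ⟨P, ω, hP, rfl⟩
  simp only [Submodule.comap_coe, Set.mem_preimage, SetLike.mem_coe, tau, TensorProduct.map_tmul]
  -- For constant `P` the truncated bound `0 - 1 = 0` would not be less than `d` when `d = 0`; here
  -- the derivative itself vanishes.
  rcases Nat.eq_zero_or_pos P.totalDegree with h0 | h0
  · rw [MvPolynomial.totalDegree_eq_zero_iff_eq_C] at h0
    rw [h0]
    simp
  · have := totalDegree_pderiv_le (w, i) P
    exact tmul_mem_degreeLT (lt_of_le_of_lt this (by omega)) _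

theorem prod_mem_degreeLT {d : ℕ} (l : List (Module.End 𝕜 (TPoly 𝕜 V ι)))
    (hl : ∀ T ∈ l, ∀ (e : ℕ), ∀ t ∈ degreeLT 𝕜 V ι (e + 1), T t ∈ degreeLT 𝕜 V ι e)
    {t : TPoly 𝕜 V ι} (ht : t ∈ degreeLT 𝕜 V ι (d + l.length)) : l.prod t ∈ degreeLT 𝕜 V ι d := by
  induction l generalizing d with
  | nil => simpa using ht
  | cons T l ih =>
    rw [List.prod_cons, Module.End.mul_apply]
    refine hl T (by simp) d _ (ih (fun S hS => hl S (by simp [hS])) ?_)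
    rw [List.length_cons] at ht
    convert ht using 2
    ring

variable {𝔤 ι₁ ι₂ : Type*} [LieRing 𝔤] [LieAlgebra 𝕜 𝔤] [Fintype ι₁] [Fintype ι₂]

theorem totalDegree_linear_le {σ τ : Type*} [Fintype τ] (c : τ → 𝕜) (x : τ → σ) :
    (∑ l, MvPolynomial.C (c l) * MvPolynomial.X (x l)).totalDegree ≤ 1 :=
  MvPolynomial.totalDegree_finsetSum_le fun l _ =>
    (MvPolynomial.totalDegree_mul _ _).trans (by simp)

theorem poissonAt_mem_degreeLT (b : Module.Basis (ι₁ ⊕ ι₂) 𝕜 𝔤) (v : V) :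
    poissonAt b v ∈ degreeLT 𝕜 V (ι₁ ⊕ ι₂) 2 :=
  Submodule.smul_mem _ _ <| Submodule.sum_mem _ fun _ _ => Submodule.sum_mem _ fun _ _ =>
    tmul_mem_degreeLT (Nat.lt_succ_of_le (totalDegree_linear_le _ _)) _

/-- Each of the `n` linear bivectors and `f` adds at most one to the degree, and `h = 1` adds none;
the last `+ 1` comes from the strict inequality in `degreeLT`. -/
theorem graphInput_mem_degreeLT (n : ℕ) (b : Module.Basis (ι₁ ⊕ ι₂) 𝕜 𝔤)
    {f : MvPolynomial (ι₁ ⊕ ι₂) 𝕜} (hf : f.totalDegree ≤ 1) :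
    graphInput n b f 1 ∈ degreeLT 𝕜 (Vert n) (ι₁ ⊕ ι₂) (n + 1 + 1) := by
  refine mul_mem_degreeLT ?_ (tmul_mem_degreeLT ?_ _)
  · have : ∀ l : List (TPoly 𝕜 (Vert n) (ι₁ ⊕ ι₂)), (∀ t ∈ l, t ∈ degreeLT 𝕜 _ _ 2) →
        l.prod ∈ degreeLT 𝕜 _ _ (l.length + 1) := by
      intro l
      induction l with
      | nil =>
        intro _
        rw [List.prod_nil, Algebra.TensorProduct.one_def]
        exact tmul_mem_degreeLT (by simp) _
      | cons s l ih =>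
        intro h
        rw [List.prod_cons, List.length_cons, Nat.add_comm l.length 1]
        exact mul_mem_degreeLT (h s (by simp)) (ih fun t ht => h t (by simp [ht]))
    have h := this (List.ofFn fun i : Fin n => poissonAt b (Sum.inl i : Vert n)) (by
      intro t ht
      obtain ⟨i, rfl⟩ := (List.mem_ofFn' _ _).mp ht
      exact poissonAt_mem_degreeLT b _)
    rwa [List.length_ofFn] at h
  · rw [map_one, mul_one]
    exact Nat.lt_succ_of_le ((MvPolynomial.totalDegree_rename_le _ _).trans hf)

theorem graphOperator_linear_eq_zero {n : ℕ} (hn : 2 ≤ n) (b : Module.Basis (ι₁ ⊕ ι₂) 𝕜 𝔤)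
    {f : MvPolynomial (ι₁ ⊕ ι₂) 𝕜} (hf : f.totalDegree ≤ 1)
    (Γ : Fin (n * 2) → Vert n × Vert n) : graphOperator Γ (graphInput n b f 1) = 0 := by
  rw [graphOperator, LinearMap.sum_apply]
  refine Finset.sum_eq_zero fun i _ => ?_
  rw [LinearMap.smul_apply]
  have h : (List.ofFn fun e => tau 𝕜 (Γ e).1 (Γ e).2 (i e)).prod (graphInput n b f 1) ∈
      degreeLT 𝕜 (Vert n) (ι₁ ⊕ ι₂) 0 := by
    refine prod_mem_degreeLT _ ?_ (degreeLT_mono ?_ (graphInput_mem_degreeLT n b hf))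
    · intro T hT e t ht
      obtain ⟨j, rfl⟩ := (List.mem_ofFn' _ _).mp hT
      exact tau_mem_degreeLT _ _ _ ht
    -- The degree count `n + 2 ≤ 2 n`, which is where `2 ≤ n` enters.
    · rw [List.length_ofFn]
      omega
  rw [degreeLT_zero, Submodule.mem_bot] at h
  rw [h, smul_zero]

/-! ### The terms of `𝔸` other than the one with `n = 1` -/

theorem equivMvPolynomial_ι (b : Module.Basis (ι₁ ⊕ ι₂) 𝕜 𝔤) (x : 𝔤) :
    SymmetricAlgebra.equivMvPolynomial b (SymmetricAlgebra.ι 𝕜 𝔤 x) =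
      ∑ l, MvPolynomial.C (b.repr x l) * MvPolynomial.X l := by
  conv_lhs => rw [← b.sum_repr x]
  simp only [map_sum, map_smul, SymmetricAlgebra.equivMvPolynomial_ι_apply,
    MvPolynomial.smul_eq_C_mul]

theorem opATerm_ι_eq_zero {n : ℕ} (hn : 2 ≤ n) (b : Module.Basis (ι₁ ⊕ ι₂) 𝕜 𝔤) (x : 𝔤) :
    opATerm b n (SymmetricAlgebra.ι 𝕜 𝔤 x) = 0 := by
  classical
  rw [opATerm, equivMvPolynomial_ι, leftActionTerm, Finset.sum_eq_zero, smul_zero, map_zero]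
  intro Γ _
  rw [graphOperator_linear_eq_zero hn b (totalDegree_linear_le _ _), map_zero]

theorem weight_zero (α : Fin (0 * 2) → OneForm 0) : weight α = 1 := by
  rw [weight, confIntegral_zero, confIntegral_zero]
  simp [koszulSign]

theorem opATerm_zero (b : Module.Basis (ι₁ ⊕ ι₂) 𝕜 𝔤) (f : SymmetricAlgebra 𝕜 𝔤) :
    opATerm b 0 f = f := by
  classical
  rw [opATerm, AlgEquiv.symm_apply_eq]
  generalize SymmetricAlgebra.equivMvPolynomial b f = P
  have : IsEmpty (Fin (0 * 2)) := inferInstanceAs (IsEmpty (Fin 0))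
  have h1 : (Finset.univ.filter fun Γ : Fin (0 * 2) → Vert 0 × Vert 0 => IsAdmissible Γ) =
      {isEmptyElim} := by
    ext Γ
    simp only [Finset.mem_filter, Finset.mem_univ, true_and, Finset.mem_singleton]
    exact ⟨fun _ => Subsingleton.elim _ _, fun _ => ⟨isEmptyElim, isEmptyElim⟩⟩
  have h2 : ∀ Γ : Fin (0 * 2) → Vert 0 × Vert 0,
      (graphOperator Γ : Module.End 𝕜 (TPoly 𝕜 (Vert 0) (ι₁ ⊕ ι₂))) = 1 := by
    intro Γ
    rw [graphOperator, Fintype.sum_unique, weight_zero]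
    simp
  rw [leftActionTerm, h1, Finset.sum_singleton, h2]
  have h3 : ((Prod.snd : Vert 0 × (ι₁ ⊕ ι₂) → ι₁ ⊕ ι₂) ∘ fun i => ((Sum.inr 0 : Vert 0), i)) = id :=
    rfl
  simp [graphInput, mulToFunctions, MvPolynomial.rename_rename, h3]

end Degree

/-! ### The graphs with one vertex of the first type -/

section OneVertex

variable {𝕜 : Type*} [RCLike 𝕜] {𝔤 ι₁ ι₂ : Type*} [LieRing 𝔤] [LieAlgebra 𝕜 𝔤]
  [Fintype ι₁] [Fintype ι₂]

open Classical in
theorem pderiv_linear {V ι : Type*} [Fintype ι] (c : ι → 𝕜) (v w : V) (i : ι) :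
    MvPolynomial.pderiv (w, i) (∑ l, MvPolynomial.C (c l) * MvPolynomial.X (v, l)) =
      MvPolynomial.C (if w = v then c i else 0) := by
  rw [map_sum]
  by_cases h : w = v
  · subst h
    rw [Finset.sum_eq_single i]
    · simp
    · intro l _ hl
      simp [MvPolynomial.pderiv_X, hl]
    · simp
  · rw [if_neg h]
    simp [MvPolynomial.pderiv_X, Ne.symm h]

theorem contractLeft_contractLeft_ι_mul_ι {M : Type*} [AddCommGroup M] [Module 𝕜 M]
    (d d' : Module.Dual 𝕜 M) (x y : M) :
    ExteriorAlgebra.algebraMapInv (CliffordAlgebra.contractLeft d (CliffordAlgebra.contractLeft d'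
      (ExteriorAlgebra.ι 𝕜 x * ExteriorAlgebra.ι 𝕜 y))) = d' x * d y - d' y * d x := by
  have h : CliffordAlgebra.contractLeft d (CliffordAlgebra.contractLeft d'
      (ExteriorAlgebra.ι 𝕜 x * ExteriorAlgebra.ι 𝕜 y)) =
      algebraMap 𝕜 (ExteriorAlgebra 𝕜 M) (d' x * d y - d' y * d x) := by
    -- The exterior algebra is the Clifford algebra of the zero form, where the contraction rules
    -- are stated.
    change CliffordAlgebra.contractLeft d (CliffordAlgebra.contractLeft d'
      (CliffordAlgebra.ι (0 : QuadraticForm 𝕜 M) x * CliffordAlgebra.ι (0 : QuadraticForm 𝕜 M) y)) =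
      algebraMap 𝕜 (CliffordAlgebra (0 : QuadraticForm 𝕜 M)) (d' x * d y - d' y * d x)
    rw [CliffordAlgebra.contractLeft_ι_mul, map_sub, map_smul, CliffordAlgebra.contractLeft_ι,
      CliffordAlgebra.contractLeft_ι, CliffordAlgebra.contractLeft_mul_algebraMap,
      CliffordAlgebra.contractLeft_ι, ← map_mul, Algebra.smul_def, ← map_mul, ← map_sub]
    ring_nf
  rw [h]
  exact ExteriorAlgebra.algebraMap_leftInverse M _

open Classical in
/-- The contribution of two edges with targets `w₀`, `w₁` and indices `i₀`, `i₁` that depart from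
the vertex of the first type. -/
def twoEdgeCoeff (b : Module.Basis (ι₁ ⊕ ι₂) 𝕜 𝔤) (x : 𝔤) (w₀ w₁ : Vert 1) (i₀ i₁ i j : ι₁ ⊕ ι₂) :
    𝕜 :=
  (if w₁ = Sum.inl 0 then b.repr ⁅b i, b j⁆ i₁ else 0) * (if w₀ = Sum.inr 0 then b.repr x i₀ else 0) +
    (if w₀ = Sum.inl 0 then b.repr ⁅b i, b j⁆ i₀ else 0) * (if w₁ = Sum.inr 0 then b.repr x i₁ else 0)

omit [Fintype ι₁] [Fintype ι₂] in
theorem twoEdgeCoeff_skew (b : Module.Basis (ι₁ ⊕ ι₂) 𝕜 𝔤) (x : 𝔤) (w₀ w₁ : Vert 1)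
    (i₀ i₁ i j : ι₁ ⊕ ι₂) :
    twoEdgeCoeff b x w₀ w₁ i₀ i₁ j i = -twoEdgeCoeff b x w₀ w₁ i₀ i₁ i j := by
  unfold twoEdgeCoeff
  rw [← lie_skew (b j) (b i)]
  simp only [map_neg, Finsupp.neg_apply]
  split_ifs <;> ring

-- Only a bivector at `z₁` is present, so a scalar remains only when both contractions act there.
-- The edge with index `i₁` acts first, which explains the order `i₁ i₀` of the last arguments. The
-- factor `1 / 2` of the bivector is used up by the two equal terms of the skew sum.
open Classical in
theorem mulToFunctions_tau_tau (b : Module.Basis (ι₁ ⊕ ι₂) 𝕜 𝔤) (x : 𝔤) (v₀ w₀ v₁ w₁ : Vert 1)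
    (i₀ i₁ : ι₁ ⊕ ι₂) :
    mulToFunctions 𝕜 (Vert 1) (ι₁ ⊕ ι₂) (tau 𝕜 v₀ w₀ i₀ (tau 𝕜 v₁ w₁ i₁ (graphInput 1 b
      (∑ l, MvPolynomial.C (b.repr x l) * MvPolynomial.X l) 1))) =
      MvPolynomial.C (if v₀ = Sum.inl 0 ∧ v₁ = Sum.inl 0 then
        twoEdgeCoeff b x w₀ w₁ i₀ i₁ i₁ i₀ else 0) := by
  have hinput : graphInput 1 b (∑ l, MvPolynomial.C (b.repr x l) * MvPolynomial.X l) 1 =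
      (1 / 2 : 𝕜) • ∑ i, ∑ j, ((∑ l, MvPolynomial.C (b.repr ⁅b i, b j⁆ l) *
        MvPolynomial.X ((Sum.inl 0 : Vert 1), l)) *
        (∑ l, MvPolynomial.C (b.repr x l) * MvPolynomial.X ((Sum.inr 0 : Vert 1), l))) ⊗ₜ[𝕜]
      (ExteriorAlgebra.ι 𝕜 (Pi.single ((Sum.inl 0 : Vert 1), i) (1 : 𝕜)) *
        ExteriorAlgebra.ι 𝕜 (Pi.single ((Sum.inl 0 : Vert 1), j) (1 : 𝕜))) := by
    simp only [graphInput, List.ofFn_succ, List.ofFn_zero, List.prod_cons, List.prod_nil, mul_one,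
      poissonAt, map_one, smul_mul_assoc, Finset.sum_mul, Algebra.TensorProduct.tmul_mul_tmul,
      map_sum, map_mul, MvPolynomial.rename_C, MvPolynomial.rename_X]
    congr!
  have hterm : ∀ i j, mulToFunctions 𝕜 (Vert 1) (ι₁ ⊕ ι₂) (tau 𝕜 v₀ w₀ i₀ (tau 𝕜 v₁ w₁ i₁
      (((∑ l, MvPolynomial.C (b.repr ⁅b i, b j⁆ l) *
        MvPolynomial.X ((Sum.inl 0 : Vert 1), l)) *
        (∑ l, MvPolynomial.C (b.repr x l) * MvPolynomial.X ((Sum.inr 0 : Vert 1), l))) ⊗ₜ[𝕜]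
      (ExteriorAlgebra.ι 𝕜 (Pi.single ((Sum.inl 0 : Vert 1), i) (1 : 𝕜)) *
        ExteriorAlgebra.ι 𝕜 (Pi.single ((Sum.inl 0 : Vert 1), j) (1 : 𝕜)))))) =
      MvPolynomial.C (twoEdgeCoeff b x w₀ w₁ i₀ i₁ i j *
        ((if (v₁, i₁) = ((Sum.inl 0 : Vert 1), i) then 1 else 0) *
          (if (v₀, i₀) = ((Sum.inl 0 : Vert 1), j) then 1 else 0) -
        (if (v₁, i₁) = ((Sum.inl 0 : Vert 1), j) then 1 else 0) *
          (if (v₀, i₀) = ((Sum.inl 0 : Vert 1), i) then 1 else 0))) := by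
    intro i j
    simp only [tau, TensorProduct.map_tmul, mulToFunctions, LinearMap.comp_apply,
      LinearEquiv.coe_coe, AlgHom.toLinearMap_apply, contractLeft_contractLeft_ι_mul_ι,
      TensorProduct.rid_tmul, Derivation.coeFn_coe, Derivation.leibniz, smul_eq_mul, map_add,
      pderiv_linear, MvPolynomial.pderiv_C, MvPolynomial.rename_C, map_mul, mul_zero, zero_add,
      LinearMap.proj_apply, Pi.single_apply, MvPolynomial.smul_eq_C_mul, twoEdgeCoeff,
      map_sub]
    ring_nf
  rw [hinput]
  simp only [map_smul, map_sum, hterm]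
  simp only [← map_sum, MvPolynomial.smul_eq_C_mul, ← map_mul]
  congr 1
  by_cases h₀ : v₀ = Sum.inl 0
  · by_cases h₁ : v₁ = Sum.inl 0
    · have h : ∑ i, ∑ j, twoEdgeCoeff b x w₀ w₁ i₀ i₁ i j *
          ((if i₁ = i then 1 else 0) * (if i₀ = j then 1 else 0) -
            (if i₁ = j then 1 else 0) * (if i₀ = i then 1 else 0)) =
          twoEdgeCoeff b x w₀ w₁ i₀ i₁ i₁ i₀ - twoEdgeCoeff b x w₀ w₁ i₀ i₁ i₀ i₁ := by
        simp [mul_sub, Finset.sum_sub_distrib, -Fintype.sum_sum_type]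
      simp only [h₀, h₁, Prod.mk.injEq, true_and, and_self, if_true]
      rw [h, twoEdgeCoeff_skew b x w₀ w₁ i₀ i₁ i₁ i₀]
      ring
    · simp [h₁]
  · simp [h₀]

/-! ### Weights and operators of graphs with two edges -/

theorem density_one (α : Fin (1 * 2) → OneForm 1) (z : Fin 1 → ℂ) :
    density α z = α 0 (slice z) (frame 1 0) * α 1 (slice z) (frame 1 1) -
      α 0 (slice z) (frame 1 1) * α 1 (slice z) (frame 1 0) :=
  Matrix.det_fin_two _

theorem confIntegral_eq_mul {n : ℕ} {α β : Fin (n * 2) → OneForm n} (c : ℝ)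
    (h : ∀ z, density α z = c * density β z) : confIntegral α = c * confIntegral β := by
  rw [confIntegral, confIntegral]
  simp only [h]
  rw [MeasureTheory.integral_const_mul]
  ring

/-- The Koszul sign of two odd factors and the orientation sign of the point are both `-1` and
cancel. -/
theorem weight_one (α : Fin (1 * 2) → OneForm 1) : weight α = confIntegral α := by
  rw [weight, confIntegral_zero]
  norm_num [koszulSign]

/-- The sign `ε₁ ε₂` of a coordinate: `-1` on `𝔨` and `+1` on `𝔭`. -/
def loopSign : ι₁ ⊕ ι₂ → ℝ := Sum.elim (fun _ => -1) (fun _ => 1)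

omit [Fintype ι₁] [Fintype ι₂] in
theorem edgeForm_loop (i : ι₁ ⊕ ι₂) :
    edgeForm (n := 1) (colour i) (Sum.inl 0, Sum.inl 0) = loopSign i • dEta (Sum.inl 0) := by
  rcases i with i | i <;> simp [edgeForm, colour, loopSign]

omit [Fintype ι₁] [Fintype ι₂] in
theorem edgeForm_edge (i : ι₁) :
    edgeForm (n := 1) (colour (Sum.inl i : ι₁ ⊕ ι₂)) (Sum.inl 0, Sum.inr 0) =
      omega 1 (-1) (Sum.inl 0) (Sum.inr 0) := by
  simp [edgeForm, colour]

omit [Fintype ι₁] [Fintype ι₂] in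
theorem confIntegral_loop_edge (α : Fin (1 * 2) → OneForm 1) (i : ι₁ ⊕ ι₂) (j : ι₁)
    (h₀ : α 0 = edgeForm (colour i) (Sum.inl 0, Sum.inl 0))
    (h₁ : α 1 = edgeForm (colour (Sum.inl j : ι₁ ⊕ ι₂)) (Sum.inl 0, Sum.inr 0)) :
    confIntegral α = loopSign i * confIntegral loopForms := by
  refine confIntegral_eq_mul _ fun z => ?_
  have l0 : loopForms 0 = dEta (Sum.inl 0) := rfl
  have l1 : loopForms 1 = omega 1 (-1) (Sum.inl 0) (Sum.inr 0) := rfl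
  rw [density_one, density_one, h₀, h₁, edgeForm_loop, edgeForm_edge, l0, l1]
  simp only [Pi.smul_apply, smul_apply, smul_eq_mul]
  ring

omit [Fintype ι₁] [Fintype ι₂] in
theorem confIntegral_edge_loop (α : Fin (1 * 2) → OneForm 1) (i : ι₁ ⊕ ι₂) (j : ι₁)
    (h₀ : α 0 = edgeForm (colour (Sum.inl j : ι₁ ⊕ ι₂)) (Sum.inl 0, Sum.inr 0))
    (h₁ : α 1 = edgeForm (colour i) (Sum.inl 0, Sum.inl 0)) :
    confIntegral α = -loopSign i * confIntegral loopForms := by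
  refine confIntegral_eq_mul _ fun z => ?_
  have l0 : loopForms 0 = dEta (Sum.inl 0) := rfl
  have l1 : loopForms 1 = omega 1 (-1) (Sum.inl 0) (Sum.inr 0) := rfl
  rw [density_one, density_one, h₀, h₁, edgeForm_loop, edgeForm_edge, l0, l1]
  simp only [Pi.smul_apply, smul_apply, smul_eq_mul]
  ring

/-- The signed trace `tr_𝔭 (ad x) - tr_𝔨 (ad x)` in coordinates. -/
def signedTrace (b : Module.Basis (ι₁ ⊕ ι₂) 𝕜 𝔤) (x : 𝔤) : 𝕜 :=
  ∑ i, ((loopSign i : ℝ) : 𝕜) * b.repr ⁅x, b i⁆ i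

open Classical in
theorem mulToFunctions_graphOperator (b : Module.Basis (ι₁ ⊕ ι₂) 𝕜 𝔤) (x : 𝔤)
    (Γ : Fin (1 * 2) → Vert 1 × Vert 1) :
    mulToFunctions 𝕜 (Vert 1) (ι₁ ⊕ ι₂) (graphOperator Γ (graphInput 1 b
      (∑ l, MvPolynomial.C (b.repr x l) * MvPolynomial.X l) 1)) =
    MvPolynomial.C (∑ i₀, ∑ i₁,
      ((confIntegral (fun e => edgeForm (colour ((![i₀, i₁] : Fin (1 * 2) → ι₁ ⊕ ι₂) e)) (Γ e)) : ℝ) : 𝕜) *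
      (if (Γ 0).1 = Sum.inl 0 ∧ (Γ 1).1 = Sum.inl 0 then
        twoEdgeCoeff b x (Γ 0).2 (Γ 1).2 i₀ i₁ i₁ i₀ else 0)) := by
  rw [← Fintype.sum_prod_type', graphOperator, LinearMap.sum_apply, map_sum, map_sum]
  refine Fintype.sum_equiv (finTwoArrowEquiv (ι₁ ⊕ ι₂)) _ _ fun i => ?_
  have hi : (![i 0, i 1] : Fin (1 * 2) → ι₁ ⊕ ι₂) = i := by
    funext e
    fin_cases e <;> rfl
  have hl : (List.ofFn fun e => tau 𝕜 (Γ e).1 (Γ e).2 (i e)).prod =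
      tau 𝕜 (Γ 0).1 (Γ 0).2 (i 0) * tau 𝕜 (Γ 1).1 (Γ 1).2 (i 1) := by
    change (List.ofFn (n := 2) fun e => tau 𝕜 (Γ e).1 (Γ e).2 (i e)).prod = _
    simp [List.ofFn_succ]
  rw [LinearMap.smul_apply, map_smul, hl, Module.End.mul_apply, mulToFunctions_tau_tau, weight_one,
    MvPolynomial.smul_eq_C_mul, ← map_mul]
  change _ = MvPolynomial.C (((confIntegral fun e =>
    edgeForm (colour ((![i 0, i 1] : Fin (1 * 2) → ι₁ ⊕ ι₂) e)) (Γ e) : ℝ) : 𝕜) * _)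
  rw [hi]
  rfl

/-- The graph with a short loop at `z₁` and an edge from `z₁` to `x₁`. -/
def loopEdge : Fin (1 * 2) → Vert 1 × Vert 1 :=
  ![(Sum.inl 0, Sum.inl 0), (Sum.inl 0, Sum.inr 0)]

/-- The graph `loopEdge` with the other order of the edges. -/
def edgeLoop : Fin (1 * 2) → Vert 1 × Vert 1 :=
  ![(Sum.inl 0, Sum.inr 0), (Sum.inl 0, Sum.inl 0)]

theorem sum_repr_lie (b : Module.Basis (ι₁ ⊕ ι₂) 𝕜 𝔤) (x y : 𝔤) (i : ι₁ ⊕ ι₂) :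
    ∑ j, b.repr x j * b.repr ⁅b j, y⁆ i = b.repr ⁅x, y⁆ i := by
  conv_rhs => rw [← b.sum_repr x]
  simp only [sum_lie, smul_lie, map_sum, map_smul, Finsupp.coe_finsetSum,
    Finset.sum_apply, Finsupp.smul_apply, smul_eq_mul]

theorem mulToFunctions_loopEdge (b : Module.Basis (ι₁ ⊕ ι₂) 𝕜 𝔤) {x : 𝔤}
    (hx : ∀ j, b.repr x (Sum.inr j) = 0) :
    mulToFunctions 𝕜 (Vert 1) (ι₁ ⊕ ι₂) (graphOperator loopEdge (graphInput 1 b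
      (∑ l, MvPolynomial.C (b.repr x l) * MvPolynomial.X l) 1)) =
    MvPolynomial.C (((confIntegral loopForms : ℝ) : 𝕜) * signedTrace b x) := by
  classical
  rw [mulToFunctions_graphOperator, signedTrace, Finset.mul_sum]
  congr 1
  refine Finset.sum_congr rfl fun i₀ _ => ?_
  rw [← sum_repr_lie b x, Finset.mul_sum, Finset.mul_sum]
  refine Finset.sum_congr rfl fun i₁ _ => ?_
  have h : twoEdgeCoeff b x (loopEdge 0).2 (loopEdge 1).2 i₀ i₁ i₁ i₀ =
      b.repr ⁅b i₁, b i₀⁆ i₀ * b.repr x i₁ := by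
    simp [twoEdgeCoeff, loopEdge]
  rw [if_pos ⟨rfl, rfl⟩, h]
  rcases i₁ with j | j
  · rw [confIntegral_loop_edge _ i₀ j rfl rfl, RCLike.ofReal_mul]
    ring
  · rw [hx]
    ring

/-- Exchanging the edges changes the sign of the wedge product and, by `twoEdgeCoeff_skew`, that of
the contraction; the result is that of `loopEdge`. -/
theorem mulToFunctions_edgeLoop (b : Module.Basis (ι₁ ⊕ ι₂) 𝕜 𝔤) {x : 𝔤}
    (hx : ∀ j, b.repr x (Sum.inr j) = 0) :
    mulToFunctions 𝕜 (Vert 1) (ι₁ ⊕ ι₂) (graphOperator edgeLoop (graphInput 1 b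
      (∑ l, MvPolynomial.C (b.repr x l) * MvPolynomial.X l) 1)) =
    MvPolynomial.C (((confIntegral loopForms : ℝ) : 𝕜) * signedTrace b x) := by
  classical
  rw [mulToFunctions_graphOperator, signedTrace, Finset.mul_sum, Finset.sum_comm]
  congr 1
  refine Finset.sum_congr rfl fun i₁ _ => ?_
  rw [← sum_repr_lie b x, Finset.mul_sum, Finset.mul_sum]
  refine Finset.sum_congr rfl fun i₀ _ => ?_
  have h : twoEdgeCoeff b x (edgeLoop 0).2 (edgeLoop 1).2 i₀ i₁ i₁ i₀ =
      -b.repr ⁅b i₀, b i₁⁆ i₁ * b.repr x i₀ := by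
    rw [twoEdgeCoeff_skew]
    simp [twoEdgeCoeff, edgeLoop]
  rw [if_pos ⟨rfl, rfl⟩, h]
  rcases i₀ with j | j
  · rw [confIntegral_edge_loop _ i₁ j rfl rfl, RCLike.ofReal_mul, RCLike.ofReal_neg]
    ring
  · rw [hx]
    ring

theorem mulToFunctions_eq_zero (b : Module.Basis (ι₁ ⊕ ι₂) 𝕜 𝔤) (x : 𝔤)
    {Γ : Fin (1 * 2) → Vert 1 × Vert 1} (h₁ : Γ ≠ loopEdge) (h₂ : Γ ≠ edgeLoop) :
    mulToFunctions 𝕜 (Vert 1) (ι₁ ⊕ ι₂) (graphOperator Γ (graphInput 1 b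
      (∑ l, MvPolynomial.C (b.repr x l) * MvPolynomial.X l) 1)) = 0 := by
  classical
  rw [mulToFunctions_graphOperator]
  rw [Finset.sum_eq_zero fun i₀ _ => Finset.sum_eq_zero fun i₁ _ => ?_, map_zero]
  by_cases h : (Γ 0).1 = Sum.inl 0 ∧ (Γ 1).1 = Sum.inl 0
  · have hΓ : Γ = (![((Γ 0).1, (Γ 0).2), ((Γ 1).1, (Γ 1).2)] : Fin (1 * 2) → Vert 1 × Vert 1) := by
      funext e
      fin_cases e <;> rfl
    have e₁ : ¬((Γ 0).2 = Sum.inl 0 ∧ (Γ 1).2 = Sum.inr 0) := fun h' => h₁ <| by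
      rw [hΓ, h.1, h.2, h'.1, h'.2, loopEdge]
    have e₂ : ¬((Γ 0).2 = Sum.inr 0 ∧ (Γ 1).2 = Sum.inl 0) := fun h' => h₂ <| by
      rw [hΓ, h.1, h.2, h'.1, h'.2, edgeLoop]
    have : twoEdgeCoeff b x (Γ 0).2 (Γ 1).2 i₀ i₁ i₁ i₀ = 0 := by
      clear hΓ h h₁ h₂
      unfold twoEdgeCoeff
      -- Each product in `twoEdgeCoeff` asks for one target `z₁` and the other `x₁`; both such
      -- target pairs have been excluded.
      split_ifs <;> simp_all
    rw [this, ite_self, mul_zero]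
  · rw [if_neg h, mul_zero]

theorem leftActionTerm_one (b : Module.Basis (ι₁ ⊕ ι₂) 𝕜 𝔤) {x : 𝔤}
    (hx : ∀ j, b.repr x (Sum.inr j) = 0) :
    leftActionTerm 1 b (∑ l, MvPolynomial.C (b.repr x l) * MvPolynomial.X l) 1 =
      MvPolynomial.C (((confIntegral loopForms : ℝ) : 𝕜) * signedTrace b x) := by
  classical
  have hne : loopEdge ≠ edgeLoop := fun h => by
    have := congrArg Prod.snd (congrFun h 0)
    simp [loopEdge, edgeLoop] at this
  have hadm : IsAdmissible loopEdge ∧ IsAdmissible edgeLoop := by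
    constructor
    all_goals
      refine ⟨fun e j => ?_, fun e e' => ?_⟩
      · fin_cases e <;> simp [loopEdge, edgeLoop]
      · fin_cases e <;> fin_cases e' <;> simp [loopEdge, edgeLoop]
  rw [leftActionTerm, ← Finset.sum_subset (s₁ := {loopEdge, edgeLoop}), Finset.sum_pair hne,
    mulToFunctions_loopEdge b hx, mulToFunctions_edgeLoop b hx, MvPolynomial.smul_eq_C_mul,
    ← map_add, ← map_mul]
  · congr 1
    -- The factor `1 / (1! 2!)` averages the two orders of the same graph.
    norm_num [Nat.factorial]
    ring
  · intro Γ hΓ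
    simp only [Finset.mem_insert, Finset.mem_singleton] at hΓ
    simp only [Finset.mem_filter, Finset.mem_univ, true_and]
    rcases hΓ with rfl | rfl
    exacts [hadm.1, hadm.2]
  · intro Γ _ hΓ
    simp only [Finset.mem_insert, Finset.mem_singleton, not_or] at hΓ
    exact mulToFunctions_eq_zero b x hΓ.1 hΓ.2

theorem opATerm_one (b : Module.Basis (ι₁ ⊕ ι₂) 𝕜 𝔤) {x : 𝔤}
    (hx : ∀ j, b.repr x (Sum.inr j) = 0) :
    opATerm b 1 (SymmetricAlgebra.ι 𝕜 𝔤 x) = algebraMap 𝕜 (SymmetricAlgebra 𝕜 𝔤)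
      (((confIntegral loopForms : ℝ) : 𝕜) * signedTrace b x) := by
  rw [opATerm, equivMvPolynomial_ι, leftActionTerm_one b hx, AlgEquiv.symm_apply_eq,
    AlgEquiv.commutes]
  rfl

end OneVertex

/-! ### Traces in an adapted basis -/

section Trace

variable {𝕜 : Type*} [RCLike 𝕜] {𝔤 ι₁ ι₂ : Type*} [LieRing 𝔤] [LieAlgebra 𝕜 𝔤]
  [Fintype ι₁] [Fintype ι₂]

theorem trace_eq_sum_repr {M ι : Type*} [AddCommGroup M] [Module 𝕜 M] [Fintype ι]
    (b : Module.Basis ι 𝕜 M) (f : M →ₗ[𝕜] M) : LinearMap.trace 𝕜 M f = ∑ i, b.repr (f (b i)) i := by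
  classical
  rw [LinearMap.trace_eq_matrix_trace 𝕜 b]
  simp [Matrix.trace, LinearMap.toMatrix_apply]

/-- The trace of `ad k` on an eigenspace of `σ`. -/
theorem trace_adPart (σ : 𝔤 →ₗ⁅𝕜⁆ 𝔤) (hσ : ∀ x, σ (σ x) = x) (b : Module.Basis (ι₁ ⊕ ι₂) 𝕜 𝔤)
    {ε : 𝕜} (hε : ε * ε = 1) (k : eigenpart σ (1 : 𝕜)) :
    LinearMap.trace 𝕜 _ (adPart σ ε k) =
      ∑ i, b.repr ⁅(k : 𝔤), (1 / 2 : 𝕜) • (b i + ε • σ (b i))⁆ i := by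
  have : Module.Finite 𝕜 𝔤 := Module.Finite.of_basis b
  -- Precomposing `ad k` with the projector `(1 + ε σ) / 2` gives an endomorphism of `𝔤` with values
  -- in the eigenspace and restriction `adPart σ ε k`. The traces agree, so the basis `b` of `𝔤` can
  -- be used without building one of the eigenspace.
  let f : 𝔤 →ₗ[𝕜] 𝔤 := (LieAlgebra.ad 𝕜 𝔤 (k : 𝔤)) ∘ₗ
    ((1 / 2 : 𝕜) • (LinearMap.id + ε • (σ : 𝔤 →ₗ[𝕜] 𝔤)))
  have hk := mem_eigenpart.mp k.2
  have hf : ∀ x, f x ∈ eigenpart σ ε := fun x => by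
    rw [mem_eigenpart]
    simp [f, hσ, hk]
    rw [smul_comm ε (2⁻¹ : 𝕜), smul_comm ε (2⁻¹ : 𝕜) (ε • _), smul_smul ε ε, hε, one_smul, add_comm]
  have hfe : f.restrict (fun x _ => hf x) = adPart σ ε k := by
    ext ⟨x, hx⟩
    have hx' := mem_eigenpart.mp hx
    have : (1 / 2 : 𝕜) • (x + ε • σ x) = x := by
      rw [hx', smul_smul, hε, one_smul, ← two_smul 𝕜 x, smul_smul]
      norm_num
    change ⁅(k : 𝔤), (1 / 2 : 𝕜) • (x + ε • σ x)⁆ = ⁅(k : 𝔤), x⁆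
    rw [this]
  rw [← hfe, LinearMap.trace_restrict_eq_of_forall_mem _ _ hf, trace_eq_sum_repr b]
  rfl

omit [Fintype ι₁] [Fintype ι₂] in
-- A `𝔭`-coordinate functional changes sign under `σ`, so on a fixed vector it equals its own
-- negative.
theorem repr_inr_eq_zero {σ : 𝔤 →ₗ⁅𝕜⁆ 𝔤} {b : Module.Basis (ι₁ ⊕ ι₂) 𝕜 𝔤}
    (hb₁ : ∀ i, σ (b (Sum.inl i)) = b (Sum.inl i))
    (hb₂ : ∀ j, σ (b (Sum.inr j)) = -b (Sum.inr j)) {x : 𝔤} (hx : σ x = x) (j : ι₂) :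
    b.repr x (Sum.inr j) = 0 := by
  classical
  have h : b.coord (Sum.inr j) ∘ₗ (σ : 𝔤 →ₗ[𝕜] 𝔤) = -b.coord (Sum.inr j) := by
    refine b.ext fun i => ?_
    rcases i with i | i
    · simp [hb₁]
    · simp [hb₂]
  have h2 := LinearMap.congr_fun h x
  simp only [LinearMap.comp_apply, LinearMap.neg_apply, Module.Basis.coord_apply] at h2
  change b.repr (σ x) (Sum.inr j) = _ at h2
  rw [hx] at h2
  exact self_eq_neg.mp h2

theorem trace_adPart_one {σ : 𝔤 →ₗ⁅𝕜⁆ 𝔤} (hσ : ∀ x, σ (σ x) = x)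
    {b : Module.Basis (ι₁ ⊕ ι₂) 𝕜 𝔤} (hb₁ : ∀ i, σ (b (Sum.inl i)) = b (Sum.inl i))
    (hb₂ : ∀ j, σ (b (Sum.inr j)) = -b (Sum.inr j)) (k : eigenpart σ (1 : 𝕜)) :
    LinearMap.trace 𝕜 _ (adPart σ 1 k) =
      ∑ i, b.repr ⁅(k : 𝔤), b (Sum.inl i)⁆ (Sum.inl i) := by
  have h : ∀ x : 𝔤, (1 / 2 : 𝕜) • (x + x) = x := fun x => by
    rw [← two_smul 𝕜 x, smul_smul]; norm_num
  rw [trace_adPart σ hσ b (by ring), Fintype.sum_sum_type]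
  simp only [hb₁, hb₂, one_smul, h, add_neg_cancel, smul_zero, lie_zero, map_zero,
    Finsupp.zero_apply, Finset.sum_const_zero, add_zero]

theorem trace_adPart_neg_one {σ : 𝔤 →ₗ⁅𝕜⁆ 𝔤} (hσ : ∀ x, σ (σ x) = x)
    {b : Module.Basis (ι₁ ⊕ ι₂) 𝕜 𝔤} (hb₁ : ∀ i, σ (b (Sum.inl i)) = b (Sum.inl i))
    (hb₂ : ∀ j, σ (b (Sum.inr j)) = -b (Sum.inr j)) (k : eigenpart σ (1 : 𝕜)) :
    LinearMap.trace 𝕜 _ (adPart σ (-1) k) =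
      ∑ j, b.repr ⁅(k : 𝔤), b (Sum.inr j)⁆ (Sum.inr j) := by
  have h : ∀ x : 𝔤, (1 / 2 : 𝕜) • (x + x) = x := fun x => by
    rw [← two_smul 𝕜 x, smul_smul]; norm_num
  rw [trace_adPart σ hσ b (by ring), Fintype.sum_sum_type]
  simp only [hb₁, hb₂, neg_smul, one_smul, neg_neg, h, add_neg_cancel, smul_zero, lie_zero,
    map_zero, Finsupp.zero_apply, Finset.sum_const_zero, zero_add]

theorem signedTrace_eq {σ : 𝔤 →ₗ⁅𝕜⁆ 𝔤} (hσ : ∀ x, σ (σ x) = x)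
    {b : Module.Basis (ι₁ ⊕ ι₂) 𝕜 𝔤} (hb₁ : ∀ i, σ (b (Sum.inl i)) = b (Sum.inl i))
    (hb₂ : ∀ j, σ (b (Sum.inr j)) = -b (Sum.inr j)) (k : eigenpart σ (1 : 𝕜)) :
    signedTrace b (k : 𝔤) =
      LinearMap.trace 𝕜 _ (adPart σ (-1) k) - LinearMap.trace 𝕜 _ (adPart σ 1 k) := by
  rw [trace_adPart_one hσ hb₁ hb₂, trace_adPart_neg_one hσ hb₁ hb₂, signedTrace,
    Fintype.sum_sum_type]
  simp only [loopSign, Sum.elim_inl, Sum.elim_inr, RCLike.ofReal_neg, RCLike.ofReal_one, neg_mul,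
    one_mul, Finset.sum_neg_distrib]
  ring

theorem trace_ad_eq {σ : 𝔤 →ₗ⁅𝕜⁆ 𝔤} (hσ : ∀ x, σ (σ x) = x)
    {b : Module.Basis (ι₁ ⊕ ι₂) 𝕜 𝔤} (hb₁ : ∀ i, σ (b (Sum.inl i)) = b (Sum.inl i))
    (hb₂ : ∀ j, σ (b (Sum.inr j)) = -b (Sum.inr j)) (k : eigenpart σ (1 : 𝕜)) :
    LinearMap.trace 𝕜 𝔤 (LieAlgebra.ad 𝕜 𝔤 (k : 𝔤)) =
      LinearMap.trace 𝕜 _ (adPart σ 1 k) + LinearMap.trace 𝕜 _ (adPart σ (-1) k) := by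
  rw [trace_adPart_one hσ hb₁ hb₂, trace_adPart_neg_one hσ hb₁ hb₂, trace_eq_sum_repr b,
    Fintype.sum_sum_type]
  rfl

theorem opA_ι (b : Module.Basis (ι₁ ⊕ ι₂) 𝕜 𝔤) (x : 𝔤) :
    opA b (SymmetricAlgebra.ι 𝕜 𝔤 x) =
      SymmetricAlgebra.ι 𝕜 𝔤 x + opATerm b 1 (SymmetricAlgebra.ι 𝕜 𝔤 x) := by
  have h : (Function.support fun n => opATerm b n (SymmetricAlgebra.ι 𝕜 𝔤 x)) ⊆
      (Finset.range 2 : Set ℕ) := by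
    intro n hn
    rw [Finset.mem_coe, Finset.mem_range]
    by_contra hlt
    exact hn (opATerm_ι_eq_zero (not_lt.mp hlt) b x)
  rw [opA, finsum_eq_sum_of_support_subset _ h, Finset.sum_range_succ, Finset.sum_range_one,
    opATerm_zero]

end Trace

end Biquantization

end

open Biquantization in
theorem mainTheorem3 {𝕜 𝔤 ι₁ ι₂ : Type*} [RCLike 𝕜] [LieRing 𝔤] [LieAlgebra 𝕜 𝔤]
    [Fintype ι₁] [Fintype ι₂] (σ : 𝔤 →ₗ⁅𝕜⁆ 𝔤) (hσ : ∀ x, σ (σ x) = x)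
    (b : Module.Basis (ι₁ ⊕ ι₂) 𝕜 𝔤)
    (hb₁ : ∀ i, σ (b (Sum.inl i)) = b (Sum.inl i))
    (hb₂ : ∀ j, σ (b (Sum.inr j)) = -b (Sum.inr j)) :
    (ConfIntegrable loopForms ∧ confIntegral loopForms = 1 / 4) ∧
    ∀ k : eigenpart σ (1 : 𝕜),
      (opATerm b 1 (SymmetricAlgebra.ι 𝕜 𝔤 k) =
        algebraMap 𝕜 (SymmetricAlgebra 𝕜 𝔤)
          (((confIntegral loopForms : ℝ) : 𝕜) *
            (LinearMap.trace 𝕜 _ (adPart σ (-1) k) - LinearMap.trace 𝕜 _ (adPart σ 1 k)))) ∧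
      (∀ n, 2 ≤ n → opATerm b n (SymmetricAlgebra.ι 𝕜 𝔤 k) = 0) ∧
      opA b (SymmetricAlgebra.ι 𝕜 𝔤 k) =
        SymmetricAlgebra.ι 𝕜 𝔤 k +
          algebraMap 𝕜 (SymmetricAlgebra 𝕜 𝔤)
            (delta σ k - 1 / 4 * LinearMap.trace 𝕜 𝔤 (LieAlgebra.ad 𝕜 𝔤 (k : 𝔤))) := by
  refine ⟨⟨confIntegrable_loopForms, confIntegral_loopForms⟩, fun k => ?_⟩
  have hk : σ (k : 𝔤) = k := by simpa using mem_eigenpart.mp k.2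
  have h1 := opATerm_one b (repr_inr_eq_zero hb₁ hb₂ hk)
  rw [signedTrace_eq hσ hb₁ hb₂] at h1
  refine ⟨h1, fun n hn => opATerm_ι_eq_zero hn b _, ?_⟩
  rw [opA_ι, h1, confIntegral_loopForms, delta, trace_ad_eq hσ hb₁ hb₂]
  -- What remains is `¼ (tr_𝔭 - tr_𝔨) = ½ tr_𝔭 - ¼ (tr_𝔨 + tr_𝔭)`.
  congr 2
  push_cast
  ring
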